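/- Let $\Omega=(a,b)$ be a bounded open interval of $\mathbb{R}$ ($a<b$), $H=L^2(\Omega)$ (real-valued), $V=H^1_0(\Omega)$, and let $A=-\Delta$ be the Dirichlet Laplacian on $H$, with domain $D(A)=\{w\in V:\Delta w\in H\}$. Let $0<\alpha<1$ and $c>0$, let $A^\alpha$ be the fractional power of $A$, and consider the equation $$u''+Au+cA^\alpha u'=0. \qquad (1)$$ A solution of (1) with data $(u_0,u_1)\in V\times H$ is a function $u\in C([0,\infty);V)\cap C^1([0,\infty);H)$ with $u(0)=u_0$, $u'(0)=u_1$ which for every $t>0$ is twice differentiable at $t$ with values in $H$, with $u(t)\in D(A)$, $u'(t)\in D(A^\alpha)$, and satisfies (1) in $H$. For $r\in\mathbb{R}$ let $G^r(\Omega)$ be the set of the functions $f\in C^\infty(\Omega)$ such that for every compact $K\subset\Omega$ there is $R>0$ with $\sup_K|f^{(p)}|\le R^p\,p^{rp}$ for all integers $p\ge1$. An element of $L^2(\Omega)$ belongs to $G^r(\Omega)$, or is analytic in $\Omega$, if it has a representative with that property. Set $$s=\max\Big\{\frac1{2\alpha},\frac1{2(1-\alpha)}\Big\}.$$ (i) For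 every real $r<s$ there is a solution of (1) with data $(u_0,u_1)\in V\times H$ such that $u(t)\notin G^r(\Omega)$ for every $t>0$. (ii) If $\alpha\neq\frac12$, there is a solution of (1) with data $(u_0,u_1)\in V\times H$ such that $u(t)$ is not real analytic in $\Omega$ for any $t>0$. -/

import Mathlib

open MeasureTheory Set
open scoped ContDiff

/-- The real Hilbert space `L²(Ω)` for `Ω ⊆ ℝ` with Lebesgue measure. -/
abbrev L2 (Ω : Set ℝ) : Type := Lp ℝ 2 (volume.restrict Ω)

/-- `φ ∈ C_c^∞(Ω)`. -/
def IsTestFunction (Ω : Set ℝ) (φ : ℝ → ℝ) : Prop :=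
  ContDiff ℝ ∞ φ ∧ HasCompactSupport φ ∧ tsupport φ ⊆ Ω

theorem IsTestFunction.zero (Ω : Set ℝ) : IsTestFunction Ω (fun _ => 0) := by
  refine ⟨contDiff_const, HasCompactSupport.zero, ?_⟩
  have h : tsupport (fun _ : ℝ => (0 : ℝ)) = ∅ := tsupport_eq_empty_iff.2 rfl
  simp [h]

theorem IsTestFunction.add {Ω : Set ℝ} {φ ψ : ℝ → ℝ} (hφ : IsTestFunction Ω φ)
    (hψ : IsTestFunction Ω ψ) : IsTestFunction Ω (φ + ψ) :=
  ⟨hφ.1.add hψ.1, hφ.2.1.add hψ.2.1,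
    (tsupport_add φ ψ).trans (union_subset hφ.2.2 hψ.2.2)⟩

theorem IsTestFunction.smul {Ω : Set ℝ} {φ : ℝ → ℝ} (k : ℝ) (hφ : IsTestFunction Ω φ) :
    IsTestFunction Ω (k • φ) :=
  ⟨contDiff_const.smul hφ.1, hφ.2.1.smul_left (f := fun _ => k),
    (tsupport_smul_subset_right (fun _ => k) φ).trans hφ.2.2⟩

theorem IsTestFunction.differentiable {Ω : Set ℝ} {φ : ℝ → ℝ} (hφ : IsTestFunction Ω φ) :
    Differentiable ℝ φ :=
  hφ.1.differentiable (by simp)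

theorem IsTestFunction.derivative {Ω : Set ℝ} {φ : ℝ → ℝ} (hφ : IsTestFunction Ω φ) :
    IsTestFunction Ω (deriv φ) :=
  ⟨(contDiff_infty_iff_deriv.1 hφ.1).2, hφ.2.1.deriv,
    tsupport_deriv_subset.trans hφ.2.2⟩

theorem IsTestFunction.memLp {Ω : Set ℝ} {φ : ℝ → ℝ} (hφ : IsTestFunction Ω φ) :
    MemLp φ 2 (volume.restrict Ω) :=
  hφ.1.continuous.memLp_of_hasCompactSupport hφ.2.1

theorem IsTestFunction.integrable_mul {Ω : Set ℝ} {φ : ℝ → ℝ} (hφ : IsTestFunction Ω φ)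
    (w : L2 Ω) : Integrable (fun x => w x * φ x) (volume.restrict Ω) :=
  (Lp.memLp w).integrable_mul hφ.memLp

/-- The pairs `(φ, φ')` with `φ ∈ C_c^∞(Ω)`, as a subspace of `L²(Ω) × L²(Ω)`. -/
def testGraph (Ω : Set ℝ) : Submodule ℝ (L2 Ω × L2 Ω) where
  carrier := {p | ∃ φ : ℝ → ℝ, IsTestFunction Ω φ ∧
    p.1 =ᵐ[volume.restrict Ω] φ ∧ p.2 =ᵐ[volume.restrict Ω] deriv φ}
  add_mem' := by
    rintro p q ⟨φ, hφ, h1, h2⟩ ⟨ψ, hψ, h3, h4⟩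
    refine ⟨φ + ψ, hφ.add hψ, (Lp.coeFn_add _ _).trans (h1.add h3), ?_⟩
    have : deriv (φ + ψ) = deriv φ + deriv ψ := by
      ext x; exact deriv_add (hφ.differentiable x) (hψ.differentiable x)
    rw [this]
    exact (Lp.coeFn_add _ _).trans (h2.add h4)
  zero_mem' := by
    refine ⟨fun _ => 0, IsTestFunction.zero Ω, Lp.coeFn_zero _ _ _, ?_⟩
    have : deriv (fun _ : ℝ => (0 : ℝ)) = 0 := by ext x; simp
    rw [this]
    exact Lp.coeFn_zero _ _ _
  smul_mem' := by
    rintro k p ⟨φ, hφ, h1, h2⟩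
    refine ⟨k • φ, hφ.smul k, (Lp.coeFn_smul _ _).trans (h1.const_smul k), ?_⟩
    have : deriv (k • φ) = k • deriv φ := by
      ext x; exact deriv_const_smul k (hφ.differentiable x)
    rw [this]
    exact (Lp.coeFn_smul _ _).trans (h2.const_smul k)

/-- The pairs `(f, f')` with `f ∈ H¹₀(Ω)` and `f'` its weak derivative: `H¹₀(Ω)` is the closure of
`C_c^∞(Ω)` for the norm `(‖f‖² + ‖f'‖²)^{1/2}`. The topology of `H¹₀(Ω)` is that of this graph. -/
noncomputable def H10Graph (Ω : Set ℝ) : Submodule ℝ (L2 Ω × L2 Ω) :=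
  (testGraph Ω).topologicalClosure

/-- The energy space `V = H¹₀(Ω)`, as a subspace of `H = L²(Ω)`. -/
noncomputable def H10 (Ω : Set ℝ) : Submodule ℝ (L2 Ω) :=
  (H10Graph Ω).map (LinearMap.fst ℝ (L2 Ω) (L2 Ω))

/-- The graph of the Dirichlet Laplacian: the pairs `(w, v)` in `L²(Ω) × L²(Ω)` with `w ∈ H¹₀(Ω)`
and `v = -w''` in the sense of distributions on `Ω`. -/
noncomputable def dirichletGraph (Ω : Set ℝ) : Submodule ℝ (L2 Ω × L2 Ω) where
  carrier := {p | p.1 ∈ H10 Ω ∧ ∀ φ : ℝ → ℝ, IsTestFunction Ω φ →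
    ∫ x in Ω, p.1 x * deriv (deriv φ) x = -∫ x in Ω, p.2 x * φ x}
  add_mem' := by
    rintro p q ⟨hp, hp'⟩ ⟨hq, hq'⟩
    refine ⟨(H10 Ω).add_mem hp hq, fun φ hφ => ?_⟩
    have e : ∀ (f g : L2 Ω) (ψ : ℝ → ℝ), IsTestFunction Ω ψ →
        ∫ x in Ω, (f + g : L2 Ω) x * ψ x = (∫ x in Ω, f x * ψ x) + ∫ x in Ω, g x * ψ x := by
      intro f g ψ hψ
      rw [← integral_add (hψ.integrable_mul f) (hψ.integrable_mul g)]
      refine integral_congr_ae ?_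
      filter_upwards [Lp.coeFn_add f g] with x hx
      simp only [hx, Pi.add_apply, add_mul]
    change ∫ x in Ω, (p.1 + q.1 : L2 Ω) x * _ = -∫ x in Ω, (p.2 + q.2 : L2 Ω) x * _
    rw [e _ _ _ hφ.derivative.derivative, e _ _ _ hφ, hp' φ hφ, hq' φ hφ]
    ring
  zero_mem' := by
    refine ⟨(H10 Ω).zero_mem, fun φ hφ => ?_⟩
    have e : ∀ ψ : ℝ → ℝ, ∫ x in Ω, (0 : L2 Ω) x * ψ x = 0 := by
      intro ψ
      rw [← integral_zero ℝ ℝ (μ := volume.restrict Ω)]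
      refine integral_congr_ae ?_
      filter_upwards [Lp.coeFn_zero ℝ 2 (volume.restrict Ω)] with x hx
      simp only [hx, Pi.zero_apply, zero_mul]
    change ∫ x in Ω, (0 : L2 Ω) x * _ = -∫ x in Ω, (0 : L2 Ω) x * _
    rw [e, e, neg_zero]
  smul_mem' := by
    rintro k p ⟨hp, hp'⟩
    refine ⟨(H10 Ω).smul_mem k hp, fun φ hφ => ?_⟩
    have e : ∀ (f : L2 Ω) (ψ : ℝ → ℝ),
        ∫ x in Ω, (k • f : L2 Ω) x * ψ x = k * ∫ x in Ω, f x * ψ x := by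
      intro f ψ
      rw [← integral_const_mul]
      refine integral_congr_ae ?_
      filter_upwards [Lp.coeFn_smul k f] with x hx
      simp only [hx, Pi.smul_apply, smul_eq_mul, mul_assoc]
    change ∫ x in Ω, (k • p.1 : L2 Ω) x * _ = -∫ x in Ω, (k • p.2 : L2 Ω) x * _
    rw [e, e, hp' φ hφ]
    ring

/-- The Dirichlet Laplacian `A = -Δ` on `L²(Ω)`, `D(A) = {w ∈ H¹₀(Ω) : Δw ∈ L²(Ω)}`. -/
noncomputable def dirichletLaplacian (Ω : Set ℝ) : L2 Ω →ₗ.[ℝ] L2 Ω :=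
  (dirichletGraph Ω).toLinearPMap

/-- For open `Ω` the graph is single valued, so `dirichletLaplacian` has the intended graph. -/
theorem dirichletLaplacian_graph {Ω : Set ℝ} (hΩ : IsOpen Ω) :
    (dirichletLaplacian Ω).graph = dirichletGraph Ω := by
  refine Submodule.toLinearPMap_graph_eq _ ?_
  rintro ⟨w, v⟩ ⟨-, h⟩ hw
  change w = 0 at hw
  subst hw
  have h0 : ∀ φ : ℝ → ℝ, IsTestFunction Ω φ → ∫ x in Ω, v x * φ x = 0 := by
    intro φ hφ
    have h1 := h φ hφ
    have h2 : ∫ x in Ω, (0 : L2 Ω) x * deriv (deriv φ) x = 0 := by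
      rw [← integral_zero ℝ ℝ (μ := volume.restrict Ω)]
      refine integral_congr_ae ?_
      filter_upwards [Lp.coeFn_zero ℝ 2 (volume.restrict Ω)] with x hx
      simp only [hx, Pi.zero_apply, zero_mul]
    change ∫ x in Ω, (0 : L2 Ω) x * deriv (deriv φ) x = -∫ x in Ω, v x * φ x at h1
    linarith
  have hloc : LocallyIntegrableOn v Ω volume :=
    locallyIntegrableOn_of_locallyIntegrable_restrict
      ((Lp.memLp v).locallyIntegrable (by norm_num))
  have key := hΩ.ae_eq_zero_of_integral_contDiff_smul_eq_zero hloc (by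
    intro g hg hgc hgs
    have h3 := h0 g ⟨hg, hgc, hgs⟩
    rw [← h3, ← integral_indicator hΩ.measurableSet]
    refine integral_congr_ae (Filter.Eventually.of_forall fun x => ?_)
    by_cases hx : x ∈ Ω
    · simp [indicator_of_mem hx, mul_comm]
    · have : g x = 0 := image_eq_zero_of_notMem_tsupport fun hh => hx (hgs hh)
      simp [indicator_of_notMem hx, this])
  change v = 0
  refine (Lp.eq_zero_iff_ae_eq_zero).2 ?_
  exact (ae_restrict_iff' hΩ.measurableSet).2 key

/-- `y = A^α x`, for a nonnegative self-adjoint operator `A` diagonalised by an orthonormal basis: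
if `A eₙ = λₙ eₙ`, then `A^α x = ∑ₙ λₙ^α ⟨eₙ, x⟩ eₙ`, and `D(A^α)` is the set of the `x` for which
the series converges. -/
def IsFracPow {H : Type*} [NormedAddCommGroup H] [InnerProductSpace ℝ H]
    (A : H →ₗ.[ℝ] H) (α : ℝ) (x y : H) : Prop :=
  ∃ (e : HilbertBasis ℕ ℝ H) (lam : ℕ → ℝ),
    (∀ n, 0 ≤ lam n ∧ (e n, lam n • e n) ∈ A.graph) ∧
    HasSum (fun n => (lam n ^ α * inner ℝ (e n) x) • e n) y

/-- `u` is the solution of `u'' + A u + c A^α u' = 0`, `A` the Dirichlet Laplacian of `Ω`, with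
`u(0) = u₀ ∈ H¹₀(Ω)` and `u'(0) = u₁ ∈ L²(Ω)`: it belongs to
`C([0,∞); H¹₀(Ω)) ∩ C¹([0,∞); L²(Ω))`, and for every `t > 0` it is twice differentiable at `t` in
`L²(Ω)`, `u(t) ∈ D(A)`, `u'(t) ∈ D(A^α)`, and the equation holds in `L²(Ω)`. Only the values of `u`
on `[0,∞)` matter. -/
structure IsDampedWaveSolution (Ω : Set ℝ) (α c : ℝ) (u₀ u₁ : L2 Ω) (u : ℝ → L2 Ω) : Prop where
  /-- Continuity of `t ↦ u(t) ∈ H¹₀(Ω)` on `[0,∞)`; `p t` is the space derivative of `u t`. -/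
  energy : ∃ p : ℝ → L2 Ω, ContinuousOn (fun t => (u t, p t)) (Ici 0) ∧
    ∀ t, 0 ≤ t → (u t, p t) ∈ H10Graph Ω
  init : u 0 = u₀
  equation : ∃ v : ℝ → L2 Ω, ContinuousOn v (Ici 0) ∧ v 0 = u₁ ∧
    (∀ t, 0 ≤ t → HasDerivWithinAt u (v t) (Ici 0) t) ∧
    ∀ t, 0 < t → ∃ Au Bv a : L2 Ω, (u t, Au) ∈ (dirichletLaplacian Ω).graph ∧
      IsFracPow (dirichletLaplacian Ω) α (v t) Bv ∧
      HasDerivAt v a t ∧ a + Au + c • Bv = 0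

/-- The (local) Gevrey class `G^s(Ω)` for open `Ω ⊆ ℝ`: `f ∈ C^∞(Ω)` and for every compact `K ⊆ Ω`
there is `R > 0` with `sup_K |f^{(p)}| ≤ R^p p^{sp}` for all `p ≥ 1`. -/
def IsGevrey (s : ℝ) (Ω : Set ℝ) (f : ℝ → ℝ) : Prop :=
  ContDiffOn ℝ ∞ f Ω ∧ ∀ K : Set ℝ, IsCompact K → K ⊆ Ω →
    ∃ R : ℝ, 0 < R ∧ ∀ p : ℕ, 1 ≤ p → ∀ x ∈ K,
      |iteratedDeriv p f x| ≤ R ^ p * (p : ℝ) ^ (s * (p : ℝ))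

/-- The element `w` of `L²(Ω)` belongs to `G^s(Ω)`, i.e. has a representative there. -/
def MemGevrey (s : ℝ) (Ω : Set ℝ) (w : L2 Ω) : Prop :=
  ∃ f : ℝ → ℝ, IsGevrey s Ω f ∧ w =ᵐ[volume.restrict Ω] f

/-- The element `w` of `L²(Ω)` has a representative that is real analytic in (the open set) `Ω`. -/
def MemAnalytic (Ω : Set ℝ) (w : L2 Ω) : Prop :=
  ∃ f : ℝ → ℝ, AnalyticOnNhd ℝ f Ω ∧ w =ᵐ[volume.restrict Ω] f

/-!
The eigenfunctions of the Dirichlet Laplacian on `(a, b)` are the sines of frequencies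
`νₙ = (n + 1)π/(b - a)`, with eigenvalues `νₙ²`, and form a Hilbert basis of `L²(a, b)`
(`sineBasis`). In this basis the equation splits into scalar equations with characteristic
polynomial `x² + c νₙ^{2α} x + νₙ²`. Its slow root `mₙ` has decay rate `-Re mₙ` comparable to
`νₙ^γ`, `γ = 2 min(α, 1 - α)`: this is half the damping coefficient when high modes oscillate, and
the small root of the overdamped equation otherwise (`exists_charRoots`). Any superposition of
modes `Re (wₙ exp (mₙ (t + 1)))` with bounded weights `w` supported on high modes is a solution: the
shift of time makes every series converge uniformly near `[0, ∞)`
(`isDampedWaveSolution_modalSeries`).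

A mode of frequency `ν` contributes about `ν^p exp (-K ν^γ)` to a derivative of order `p` at the
midpoint of the interval. For `p` about `ν^γ` this is `(D p^{1/γ})^p`, the growth at the border of
the Gevrey class of order `s = 1/γ`. It remains to prevent cancellation. The weights live on very
sparse pairs of neighbouring modes `N k`, `N k + 1`, so that for this `p` all other pairs are
negligible (`abs_tsum_ge_of_sparse`, `exists_sparse_seq`); and at the midpoint the derivatives of
order `p` of the eigenfunctions of one parity vanish, which separates the two members of a pair
(`sineSeries_midpoint`). Pairs are needed because an oscillating mode may vanish at the given time:
frequency gaps inside the pairs converge, and the relative phase of the pair alternates between `0`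
and `π/2`, so both members cannot be small in all late pairs (`frequently_le_abs_modalCoef`).

Since only derivatives at one interior point are used, one and the same solution violates every
Gevrey bound of order `r < s`, and, as an analytic function satisfies the bound of order `1`, is
analytic in `(a, b)` at no time `t > 0` when `s > 1`, that is, when `α ≠ 1/2`.
-/

/-! ### The sine basis of `L²(a, b)` -/

/-- The frequencies `νₙ = (n + 1)π/(b - a)`; the Dirichlet eigenvalues of `(a, b)` are the `νₙ²`. -/
noncomputable def sineFreq (a b : ℝ) (n : ℕ) : ℝ := (n + 1) * Real.pi / (b - a)

theorem sineFreq_pos {a b : ℝ} (hab : a < b) (n : ℕ) : 0 < sineFreq a b n := by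
  have := sub_pos.2 hab
  unfold sineFreq; positivity

/-- The normalised Dirichlet eigenfunctions of `(a, b)`. -/
noncomputable def sineFun (a b : ℝ) (n : ℕ) (x : ℝ) : ℝ :=
  √(2 / (b - a)) * Real.sin (sineFreq a b n * (x - a))

theorem memLp_Ioo_of_continuous (a b : ℝ) {ψ : ℝ → ℝ} (hψ : Continuous ψ) :
    MemLp ψ 2 (volume.restrict (Ioo a b)) := by
  obtain ⟨C, hC⟩ := isCompact_Icc.exists_bound_of_continuousOn (s := Icc a b) hψ.continuousOn
  refine MemLp.of_bound hψ.aestronglyMeasurable C ?_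
  filter_upwards [ae_restrict_mem measurableSet_Ioo] with x hx
  exact hC x (Ioo_subset_Icc_self hx)

/-- The element of `L²(a, b)` given by a function continuous on `ℝ`. -/
noncomputable def contToL2 (a b : ℝ) (ψ : ℝ → ℝ) (hψ : Continuous ψ) : L2 (Ioo a b) :=
  (memLp_Ioo_of_continuous a b hψ).toLp ψ

theorem coeFn_contToL2 (a b : ℝ) (ψ : ℝ → ℝ) (hψ : Continuous ψ) :
    contToL2 a b ψ hψ =ᵐ[volume.restrict (Ioo a b)] ψ :=
  MemLp.coeFn_toLp (memLp_Ioo_of_continuous a b hψ)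

theorem L2_inner_eq_integral {Ω : Set ℝ} (f g : L2 Ω) {F G : ℝ → ℝ}
    (hf : f =ᵐ[volume.restrict Ω] F) (hg : g =ᵐ[volume.restrict Ω] G) :
    inner ℝ f g = ∫ x in Ω, G x * F x := by
  rw [MeasureTheory.L2.inner_def]
  refine integral_congr_ae ?_
  filter_upwards [hf, hg] with x h1 h2
  rw [h1, h2]; rfl

theorem integral_cos_int_mul_pi {a b : ℝ} (hab : a < b) (j : ℤ) :
    ∫ x in a..b, Real.cos (j * Real.pi / (b - a) * (x - a)) = if j = 0 then b - a else 0 := by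
  split_ifs with h
  · simp [h]
  · have hL : b - a ≠ 0 := (sub_pos.2 hab).ne'
    have hk : (j : ℝ) * Real.pi / (b - a) ≠ 0 :=
      div_ne_zero (mul_ne_zero (by exact_mod_cast h) Real.pi_ne_zero) hL
    set k : ℝ := (j : ℝ) * Real.pi / (b - a) with hkdef
    rw [intervalIntegral.integral_eq_sub_of_hasDerivAt
      (f := fun x => k⁻¹ * Real.sin (k * (x - a)))]
    · have : k * (b - a) = j * Real.pi := by rw [hkdef]; field_simp
      simp [this, Real.sin_int_mul_pi]
    · intro x _
      have h1 : HasDerivAt (fun x : ℝ => k * (x - a)) k x := by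
        simpa using ((hasDerivAt_id x).sub_const a).const_mul k
      have := (h1.sin).const_mul k⁻¹
      rwa [mul_left_comm, inv_mul_cancel₀ hk, mul_one] at this
    · exact (by fun_prop : Continuous fun x => Real.cos (k * (x - a))).intervalIntegrable _ _

theorem continuous_sineFun (a b : ℝ) (n : ℕ) : Continuous (sineFun a b n) := by
  unfold sineFun; fun_prop

theorem integral_sineFun_mul_sineFun {a b : ℝ} (hab : a < b) (m n : ℕ) :
    ∫ x in Ioo a b, sineFun a b n x * sineFun a b m x = if m = n then 1 else 0 := by
  have hL : 0 < b - a := sub_pos.2 hab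
  have e : ∀ x, sineFun a b n x * sineFun a b m x = (b - a)⁻¹ *
      (Real.cos (((n - m : ℤ) : ℝ) * Real.pi / (b - a) * (x - a)) -
        Real.cos (((n + m + 2 : ℤ) : ℝ) * Real.pi / (b - a) * (x - a))) := by
    intro x
    have h1 : ((n - m : ℤ) : ℝ) * Real.pi / (b - a) * (x - a) =
        sineFreq a b n * (x - a) - sineFreq a b m * (x - a) := by
      unfold sineFreq; push_cast; ring
    have h2 : ((n + m + 2 : ℤ) : ℝ) * Real.pi / (b - a) * (x - a) =
        sineFreq a b n * (x - a) + sineFreq a b m * (x - a) := by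
      unfold sineFreq; push_cast; ring
    have h3 : √(2 / (b - a)) * √(2 / (b - a)) = 2 / (b - a) := Real.mul_self_sqrt (by positivity)
    rw [h1, h2, Real.cos_sub, Real.cos_add]
    unfold sineFun
    rw [mul_mul_mul_comm, h3]
    ring
  simp_rw [e]
  rw [← integral_Ioc_eq_integral_Ioo, ← intervalIntegral.integral_of_le hab.le,
    intervalIntegral.integral_const_mul, intervalIntegral.integral_sub, integral_cos_int_mul_pi hab,
    integral_cos_int_mul_pi hab]
  · rw [if_neg (by omega : ¬ ((n : ℤ) + m + 2 = 0))]
    by_cases h : m = n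
    · simp [h, hL.ne']
    · rw [if_neg (by omega), if_neg h]; simp
  · exact (by fun_prop : Continuous fun x =>
      Real.cos (((n - m : ℤ) : ℝ) * Real.pi / (b - a) * (x - a))).intervalIntegrable _ _
  · exact (by fun_prop : Continuous fun x =>
      Real.cos (((n + m + 2 : ℤ) : ℝ) * Real.pi / (b - a) * (x - a))).intervalIntegrable _ _

/-- The element of `L²(a, b)` given by the `n`-th Dirichlet eigenfunction. -/
noncomputable def sineL2 (a b : ℝ) (n : ℕ) : L2 (Ioo a b) :=
  contToL2 a b (sineFun a b n) (continuous_sineFun a b n)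

theorem coeFn_sineL2 (a b : ℝ) (n : ℕ) :
    sineL2 a b n =ᵐ[volume.restrict (Ioo a b)] sineFun a b n :=
  coeFn_contToL2 _ _ _ _

theorem orthonormal_sineL2 {a b : ℝ} (hab : a < b) : Orthonormal ℝ (sineL2 a b) := by
  rw [orthonormal_iff_ite]
  intro m n
  rw [← integral_sineFun_mul_sineFun hab m n]
  exact L2_inner_eq_integral _ _ (coeFn_sineL2 _ _ _) (coeFn_sineL2 _ _ _)

/-- Multiplying `f` by `cos` raises and lowers the frequency of the sine moments, so `f sin` is
orthogonal to every power of `cos`. -/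
theorem integral_mul_sin_mul_cos_pow_eq_zero {a b : ℝ} {f : ℝ → ℝ}
    (hf : IntegrableOn f (Ioo a b)) (h : ∀ n : ℕ,
      ∫ x in Ioo a b, f x * Real.sin (sineFreq a b n * (x - a)) = 0) (k : ℕ) :
    ∀ j : ℕ, ∫ x in Ioo a b, f x * (Real.sin (j * (Real.pi / (b - a) * (x - a))) *
      Real.cos (Real.pi / (b - a) * (x - a)) ^ k) = 0 := by
  have hint : ∀ (g : ℝ → ℝ), Continuous g → (∀ x, |g x| ≤ 1) →
      IntegrableOn (fun x => f x * g x) (Ioo a b) := by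
    intro g hg hg1
    exact hf.mul_bdd (c := 1) hg.aestronglyMeasurable (Filter.Eventually.of_forall hg1)
  induction k with
  | zero =>
    rintro (_ | j)
    · simp
    · rw [← h j]
      refine integral_congr_ae (Filter.Eventually.of_forall fun x => ?_)
      have : (((j + 1 : ℕ) : ℝ) * (Real.pi / (b - a) * (x - a))) = sineFreq a b j * (x - a) := by
        unfold sineFreq; push_cast; ring
      simp only [this, pow_zero, mul_one]
  | succ k ih =>
    rintro (_ | j)
    · simp
    · have e : ∀ x, f x * (Real.sin ((j + 1 : ℕ) * (Real.pi / (b - a) * (x - a))) *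
          Real.cos (Real.pi / (b - a) * (x - a)) ^ (k + 1)) =
          (1 / 2) * (f x * (Real.sin ((j + 2 : ℕ) * (Real.pi / (b - a) * (x - a))) *
            Real.cos (Real.pi / (b - a) * (x - a)) ^ k)) +
          (1 / 2) * (f x * (Real.sin (j * (Real.pi / (b - a) * (x - a))) *
            Real.cos (Real.pi / (b - a) * (x - a)) ^ k)) := by
        intro x
        set θ := Real.pi / (b - a) * (x - a)
        have h1 : ((j + 2 : ℕ) : ℝ) * θ = (j + 1 : ℕ) * θ + θ := by push_cast; ring
        have h2 : ((j : ℕ) : ℝ) * θ = (j + 1 : ℕ) * θ - θ := by push_cast; ring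
        rw [h1, h2, Real.sin_add, Real.sin_sub]
        ring
      have hb : ∀ j : ℕ, IntegrableOn (fun x => (1 / 2) * (f x *
          (Real.sin (j * (Real.pi / (b - a) * (x - a))) *
            Real.cos (Real.pi / (b - a) * (x - a)) ^ k))) (Ioo a b) := by
        intro j
        refine (hint _ (by fun_prop) fun x => ?_).const_mul _
        rw [abs_mul, abs_pow]
        exact mul_le_one₀ (Real.abs_sin_le_one _) (by positivity)
          (pow_le_one₀ (abs_nonneg _) (Real.abs_cos_le_one _))
      simp_rw [e]
      rw [integral_add (hb _) (hb _), integral_const_mul, integral_const_mul, ih, ih]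
      simp

/-- A function all of whose sine moments vanish is zero. By the Weierstrass theorem every
continuous function on `[a, b]` is a uniform limit of polynomials in `cos (π(x - a)/(b - a))`. -/
theorem ae_eq_zero_of_sine_moments {a b : ℝ} (hab : a < b) {f : ℝ → ℝ}
    (hf : IntegrableOn f (Ioo a b)) (h : ∀ n : ℕ,
      ∫ x in Ioo a b, f x * Real.sin (sineFreq a b n * (x - a)) = 0) :
    f =ᵐ[volume.restrict (Ioo a b)] 0 := by
  have hL : 0 < b - a := sub_pos.2 hab
  set θ : ℝ → ℝ := fun x => Real.pi / (b - a) * (x - a) with hθ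
  have hθc : Continuous θ := by fun_prop
  have hθ0 : ∀ x ∈ Ioo a b, 0 < θ x ∧ θ x < Real.pi := by
    intro x hx
    refine ⟨mul_pos (by positivity) (sub_pos.2 hx.1), ?_⟩
    have : Real.pi / (b - a) * (x - a) < Real.pi / (b - a) * (b - a) := by
      apply mul_lt_mul_of_pos_left _ (by positivity)
      linarith [hx.2]
    rwa [div_mul_cancel₀ _ hL.ne'] at this
  set g : ℝ → ℝ := fun x => f x * Real.sin (θ x) with hg
  have hgi : IntegrableOn g (Ioo a b) :=
    hf.mul_bdd (c := 1) (by fun_prop : Continuous fun x => Real.sin (θ x)).aestronglyMeasurable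
      (Filter.Eventually.of_forall fun x => Real.abs_sin_le_one _)
  have hgb : ∀ {ψ : ℝ → ℝ}, Continuous ψ → IntegrableOn (fun x => g x * ψ x) (Ioo a b) := by
    intro ψ hψ
    obtain ⟨C, hC⟩ := isCompact_Icc.exists_bound_of_continuousOn (s := Icc a b) hψ.continuousOn
    refine hgi.mul_bdd (c := C) hψ.aestronglyMeasurable ?_
    filter_upwards [ae_restrict_mem measurableSet_Ioo] with x hx
    exact hC x (Ioo_subset_Icc_self hx)
  have hpoly : ∀ P : Polynomial ℝ, ∫ x in Ioo a b, g x * P.eval (Real.cos (θ x)) = 0 := by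
    intro P
    induction P using Polynomial.induction_on' with
    | add p q hp hq =>
      simp_rw [Polynomial.eval_add, mul_add]
      rw [integral_add (hgb (by fun_prop)) (hgb (by fun_prop)), hp, hq, add_zero]
    | monomial k c =>
      have := integral_mul_sin_mul_cos_pow_eq_zero hf h k 1
      have e : ∀ x, g x * (Polynomial.monomial k c).eval (Real.cos (θ x)) =
          c * (f x * (Real.sin ((1 : ℕ) * (Real.pi / (b - a) * (x - a))) *
            Real.cos (Real.pi / (b - a) * (x - a)) ^ k)) := by
        intro x
        simp only [hg, hθ, Polynomial.eval_monomial, Nat.cast_one, one_mul]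
        ring
      simp_rw [e]
      rw [integral_const_mul, this, mul_zero]
  have hcont : ∀ ψ : ℝ → ℝ, Continuous ψ → ∫ x in Ioo a b, g x * ψ x = 0 := by
    intro ψ hψ
    set I := ∫ x in Ioo a b, |g x| with hI
    have hI0 : 0 ≤ I := integral_nonneg fun x => abs_nonneg _
    have hle : ∀ ε > 0, |∫ x in Ioo a b, g x * ψ x| ≤ I * ε := by
      intro ε hε
      obtain ⟨P, hP⟩ := exists_polynomial_near_of_continuousOn (-1) 1
        (fun y => ψ (a + (b - a) / Real.pi * Real.arccos y))
        (by fun_prop (disch := exact Real.continuous_arccos)) ε hε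
      have hψP : ∀ x ∈ Ioo a b, |ψ x - P.eval (Real.cos (θ x))| ≤ ε := by
        intro x hx
        have h1 := hP (Real.cos (θ x)) ⟨Real.neg_one_le_cos _, Real.cos_le_one _⟩
        rw [Real.arccos_cos (hθ0 x hx).1.le (hθ0 x hx).2.le] at h1
        have h2 : a + (b - a) / Real.pi * θ x = x := by
          simp only [hθ]; field_simp; ring
        rw [h2, abs_sub_comm] at h1
        exact h1.le
      have h3 : ∫ x in Ioo a b, g x * ψ x =
          ∫ x in Ioo a b, g x * (ψ x - P.eval (Real.cos (θ x))) := by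
        simp_rw [mul_sub]
        rw [integral_sub (hgb hψ) (hgb (by fun_prop)), hpoly, sub_zero]
      rw [h3]
      refine (abs_integral_le_integral_abs).trans ?_
      rw [hI, ← integral_mul_const]
      refine setIntegral_mono_on (hgb (by fun_prop)).abs (hgi.abs.mul_const ε) measurableSet_Ioo ?_
      intro x hx
      rw [abs_mul]
      exact mul_le_mul_of_nonneg_left (hψP x hx) (abs_nonneg _)
    by_contra hne
    have hpos : 0 < |∫ x in Ioo a b, g x * ψ x| := abs_pos.2 hne
    have := hle (|∫ x in Ioo a b, g x * ψ x| / (2 * (I + 1))) (by positivity)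
    rw [mul_div_assoc', le_div_iff₀ (by positivity)] at this
    nlinarith
  have key := isOpen_Ioo.ae_eq_zero_of_integral_contDiff_smul_eq_zero (f := g) (μ := volume)
    hgi.locallyIntegrableOn (by
      intro ψ hψ _ hψs
      rw [← hcont ψ hψ.continuous, ← integral_indicator measurableSet_Ioo]
      refine integral_congr_ae (Filter.Eventually.of_forall fun x => ?_)
      by_cases hx : x ∈ Ioo a b
      · simp [indicator_of_mem hx, mul_comm]
      · have : ψ x = 0 := image_eq_zero_of_notMem_tsupport fun hh => hx (hψs hh)
        simp [indicator_of_notMem hx, this])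
  refine (ae_restrict_iff' measurableSet_Ioo).2 ?_
  filter_upwards [key] with x hx hxm
  exact (mul_eq_zero.1 (hx hxm)).resolve_right (Real.sin_pos_of_pos_of_lt_pi (hθ0 x hxm).1
    (hθ0 x hxm).2).ne'

/-- The Dirichlet eigenfunctions of `(a, b)` as a Hilbert basis of `L²(a, b)`. -/
noncomputable def sineBasis {a b : ℝ} (hab : a < b) : HilbertBasis ℕ ℝ (L2 (Ioo a b)) :=
  HilbertBasis.mkOfOrthogonalEqBot (orthonormal_sineL2 hab) (by
    rw [Submodule.eq_bot_iff]
    intro f hf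
    rw [Submodule.mem_orthogonal] at hf
    refine Lp.eq_zero_iff_ae_eq_zero.2 ?_
    refine ae_eq_zero_of_sine_moments hab ((Lp.memLp f).integrable (by norm_num)) fun n => ?_
    have h1 := hf (sineL2 a b n) (Submodule.subset_span ⟨n, rfl⟩)
    rw [L2_inner_eq_integral _ _ (coeFn_sineL2 _ _ _) Filter.EventuallyEq.rfl] at h1
    have h2 : ∀ x, f x * sineFun a b n x =
        √(2 / (b - a)) * (f x * Real.sin (sineFreq a b n * (x - a))) := by
      intro x; unfold sineFun; ring
    simp_rw [h2] at h1
    rw [integral_const_mul] at h1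
    have hL : 0 < b - a := sub_pos.2 hab
    exact (mul_eq_zero.1 h1).resolve_left (by positivity))

theorem coe_sineBasis {a b : ℝ} (hab : a < b) : ⇑(sineBasis hab) = sineL2 a b :=
  HilbertBasis.coe_mkOfOrthogonalEqBot _ _

/-! ### Eigenfunctions in the energy space and in the domain of the Laplacian -/

theorem tendsto_contToL2 {a b : ℝ} {g : ℕ → ℝ → ℝ} (hg : ∀ k, Continuous (g k)) {f : ℝ → ℝ}
    (hf : Continuous f) (C : ℝ) (hC : ∀ k, ∀ x ∈ Ioo a b, |g k x| ≤ C)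
    (hlim : ∀ x ∈ Ioo a b, Filter.Tendsto (fun k => g k x) Filter.atTop (nhds (f x))) :
    Filter.Tendsto (fun k => contToL2 a b (g k) (hg k)) Filter.atTop
      (nhds (contToL2 a b f hf)) := by
  rw [tendsto_iff_norm_sub_tendsto_zero]
  have e : ∀ k, ‖contToL2 a b (g k) (hg k) - contToL2 a b f hf‖ ^ 2 =
      ∫ x in Ioo a b, (g k x - f x) * (g k x - f x) := by
    intro k
    rw [← real_inner_self_eq_norm_sq]
    have : (contToL2 a b (g k) (hg k) - contToL2 a b f hf : L2 (Ioo a b))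
        =ᵐ[volume.restrict (Ioo a b)] fun x => g k x - f x := by
      filter_upwards [Lp.coeFn_sub (contToL2 a b (g k) (hg k)) (contToL2 a b f hf),
        coeFn_contToL2 a b (g k) (hg k), coeFn_contToL2 a b f hf] with x h1 h2 h3
      rw [h1, Pi.sub_apply, h2, h3]
    exact L2_inner_eq_integral _ _ this this
  have hfC : ∀ x ∈ Ioo a b, |f x| ≤ C := fun x hx =>
    le_of_tendsto (hlim x hx).abs (Filter.Eventually.of_forall fun k => hC k x hx)
  have h0 : Filter.Tendsto (fun k => ∫ x in Ioo a b, (g k x - f x) * (g k x - f x))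
      Filter.atTop (nhds (∫ x in Ioo a b, (0 : ℝ))) := by
    refine tendsto_integral_of_dominated_convergence (fun _ => (C + C) * (C + C)) ?_ ?_ ?_ ?_
    · intro k
      exact (((hg k).sub hf).mul ((hg k).sub hf)).aestronglyMeasurable
    · exact integrable_const _
    · intro k
      filter_upwards [ae_restrict_mem measurableSet_Ioo] with x hx
      have h1 : |g k x - f x| ≤ C + C :=
        (abs_sub _ _).trans (add_le_add (hC k x hx) (hfC x hx))
      rw [Real.norm_eq_abs, abs_mul]
      exact mul_le_mul h1 h1 (abs_nonneg _) ((abs_nonneg _).trans h1)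
    · filter_upwards [ae_restrict_mem measurableSet_Ioo] with x hx
      have := (hlim x hx).sub_const (f x)
      simpa using this.mul this
  simp_rw [← e] at h0
  have := h0.sqrt
  simpa using this

theorem deriv_smoothTransition_eq_zero {y : ℝ} (hy : y < 0 ∨ 1 < y) :
    deriv Real.smoothTransition y = 0 := by
  rcases hy with hy | hy
  · have : Real.smoothTransition =ᶠ[nhds y] fun _ => 0 := by
      filter_upwards [gt_mem_nhds hy] with z hz using Real.smoothTransition.zero_of_nonpos hz.le
    rw [this.deriv_eq, deriv_const]
  · have : Real.smoothTransition =ᶠ[nhds y] fun _ => 1 := by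
      filter_upwards [lt_mem_nhds hy] with z hz using Real.smoothTransition.one_of_one_le hz.le
    rw [this.deriv_eq, deriv_const]

theorem continuous_deriv_smoothTransition : Continuous (deriv Real.smoothTransition) :=
  (Real.smoothTransition.contDiff (n := 1)).continuous_deriv le_rfl

theorem exists_bound_mul_deriv_smoothTransition :
    ∃ M : ℝ, ∀ y : ℝ, |y * deriv Real.smoothTransition (y - 1)| ≤ M := by
  obtain ⟨M, hM⟩ := isCompact_Icc.exists_bound_of_continuousOn (s := Icc (1 : ℝ) 2)
    (f := fun y => y * deriv Real.smoothTransition (y - 1))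
    (continuous_id.mul (continuous_deriv_smoothTransition.comp
      (continuous_id.sub continuous_const))).continuousOn
  refine ⟨M, fun y => ?_⟩
  by_cases hy : y ∈ Icc (1 : ℝ) 2
  · exact hM y hy
  · have h0 : 0 ≤ M := (norm_nonneg _).trans (hM 1 (by simp))
    rw [deriv_smoothTransition_eq_zero, mul_zero, abs_zero]
    · exact h0
    · simp only [mem_Icc, not_and_or, not_le] at hy
      exact hy.imp (by intro; linarith) (by intro; linarith)

/-- A smooth cutoff of `(a, b)`, equal to `1` at distance at least `2 / (k + 1)` from the end
points and to `0` at distance at most `1 / (k + 1)`. -/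
noncomputable def cutoff (a b : ℝ) (k : ℕ) (x : ℝ) : ℝ :=
  Real.smoothTransition ((k + 1) * (x - a) - 1) * Real.smoothTransition ((k + 1) * (b - x) - 1)

theorem contDiff_cutoff (a b : ℝ) (k : ℕ) : ContDiff ℝ ∞ (cutoff a b k) := by
  have h : ContDiff ℝ ∞ Real.smoothTransition := Real.smoothTransition.contDiff
  unfold cutoff
  exact (h.comp (by fun_prop)).mul (h.comp (by fun_prop))

theorem deriv_cutoff (a b : ℝ) (k : ℕ) (x : ℝ) : deriv (cutoff a b k) x =
    (k + 1) * deriv Real.smoothTransition ((k + 1) * (x - a) - 1) *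
      Real.smoothTransition ((k + 1) * (b - x) - 1) -
    Real.smoothTransition ((k + 1) * (x - a) - 1) *
      ((k + 1) * deriv Real.smoothTransition ((k + 1) * (b - x) - 1)) := by
  have hd : ∀ y, HasDerivAt Real.smoothTransition (deriv Real.smoothTransition y) y := fun y =>
    ((Real.smoothTransition.contDiff (n := 1)).differentiable (by simp) y).hasDerivAt
  have h1 : HasDerivAt (fun x : ℝ => ((k : ℝ) + 1) * (x - a) - 1) (k + 1) x := by
    simpa using (((hasDerivAt_id x).sub_const a).const_mul ((k : ℝ) + 1)).sub_const 1
  have h2 : HasDerivAt (fun x : ℝ => ((k : ℝ) + 1) * (b - x) - 1) (-(k + 1)) x := by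
    simpa using (((hasDerivAt_id x).const_sub b).const_mul ((k : ℝ) + 1)).sub_const 1
  have h3 := ((hd _).comp x h1).mul ((hd _).comp x h2)
  have : deriv (cutoff a b k) x = _ := h3.deriv
  rw [this]
  simp only [Function.comp_apply]
  ring

theorem isTestFunction_cutoff_mul (a b : ℝ) (k : ℕ) {ψ : ℝ → ℝ} (hψ : ContDiff ℝ ∞ ψ) :
    IsTestFunction (Ioo a b) (fun x => cutoff a b k x * ψ x) := by
  have hk : (0 : ℝ) < k + 1 := by positivity
  have hs : Function.support (fun x => cutoff a b k x * ψ x) ⊆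
      Icc (a + 1 / (k + 1)) (b - 1 / (k + 1)) := by
    intro x hx
    have h := left_ne_zero_of_mul hx
    have h1 := left_ne_zero_of_mul h
    have h2 := right_ne_zero_of_mul h
    rw [Ne, Real.smoothTransition.zero_iff_nonpos, not_le] at h1 h2
    constructor
    · have : 1 / ((k : ℝ) + 1) ≤ x - a := by rw [div_le_iff₀ hk]; linarith
      linarith
    · have : 1 / ((k : ℝ) + 1) ≤ b - x := by rw [div_le_iff₀ hk]; linarith
      linarith
  refine ⟨(contDiff_cutoff a b k).mul hψ, HasCompactSupport.of_support_subset_isCompact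
    isCompact_Icc hs, (closure_minimal hs isClosed_Icc).trans ?_⟩
  have : (0 : ℝ) < 1 / (k + 1) := by positivity
  exact Icc_subset_Ioo (by linarith) (by linarith)

/-- A smooth function vanishing at both ends of `(a, b)` belongs to `H¹₀(a, b)`: multiplied by the
cutoffs it converges in `H¹`, since near the end points the growth `O(k)` of the derivative of the
cutoff is compensated by the decay `O(1 / k)` of the function. -/
theorem contToL2_mem_H10Graph {a b : ℝ} (hab : a < b) {ψ : ℝ → ℝ} (hψ : ContDiff ℝ ∞ ψ)
    (ha : ψ a = 0) (hb : ψ b = 0) (hψ' : Continuous (deriv ψ)) :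
    (contToL2 a b ψ hψ.continuous, contToL2 a b (deriv ψ) hψ') ∈ H10Graph (Ioo a b) := by
  set φ : ℕ → ℝ → ℝ := fun k x => cutoff a b k x * ψ x with hφ
  have ht : ∀ k, IsTestFunction (Ioo a b) (φ k) := fun k => isTestFunction_cutoff_mul a b k hψ
  have hψd : Differentiable ℝ ψ := hψ.differentiable (by simp)
  have hφ' : ∀ k x, deriv (φ k) x = deriv (cutoff a b k) x * ψ x + cutoff a b k x * deriv ψ x :=
    fun k x => deriv_mul ((contDiff_cutoff a b k).differentiable (by simp) x) (hψd x)
  obtain ⟨M, hM⟩ := isCompact_Icc.exists_bound_of_continuousOn (s := Icc a b) hψ'.continuousOn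
  obtain ⟨C, hC⟩ := isCompact_Icc.exists_bound_of_continuousOn (s := Icc a b)
    hψ.continuous.continuousOn
  obtain ⟨M', hM'⟩ := exists_bound_mul_deriv_smoothTransition
  have hM0 : 0 ≤ M := (norm_nonneg _).trans (hM a (left_mem_Icc.2 hab.le))
  have hLip : ∀ x ∈ Icc a b, ∀ y ∈ Icc a b, |ψ x - ψ y| ≤ M * |x - y| := fun x hx y hy =>
    (convex_Icc a b).norm_image_sub_le_of_norm_deriv_le (fun z _ => hψd z) hM hy hx
  have hT : ∀ y, |Real.smoothTransition y| ≤ 1 := fun y => by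
    rw [abs_of_nonneg (Real.smoothTransition.nonneg _)]; exact Real.smoothTransition.le_one _
  have hcut : ∀ k x, |cutoff a b k x| ≤ 1 := fun k x => by
    unfold cutoff; rw [abs_mul]; exact mul_le_one₀ (hT _) (abs_nonneg _) (hT _)
  have hev : ∀ x ∈ Ioo a b, ∀ᶠ k : ℕ in Filter.atTop,
      1 < ((k : ℝ) + 1) * (x - a) - 1 ∧ 1 < ((k : ℝ) + 1) * (b - x) - 1 := by
    intro x hx
    have h := fun {y : ℝ} (hy : 0 < y) =>
      ((tendsto_natCast_atTop_atTop (R := ℝ)).atTop_add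
        (tendsto_const_nhds (x := (1 : ℝ)))).atTop_mul_const hy
    filter_upwards [(h (sub_pos.2 hx.1)).eventually_gt_atTop 2,
      (h (sub_pos.2 hx.2)).eventually_gt_atTop 2] with k h1 h2
    constructor <;> linarith
  refine mem_closure_of_tendsto (f := fun k => (contToL2 a b (φ k) (ht k).1.continuous,
    contToL2 a b (deriv (φ k)) (ht k).derivative.1.continuous)) (b := Filter.atTop) ?_ ?_
  · refine Filter.Tendsto.prodMk_nhds (tendsto_contToL2 _ _ C ?_ ?_)
      (tendsto_contToL2 _ _ (M * M' + M * M' + M) ?_ ?_)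
    · intro k x hx
      simp only [hφ, abs_mul]
      exact (mul_le_of_le_one_left (abs_nonneg _) (hcut k x)).trans
        (hC x (Ioo_subset_Icc_self hx))
    · intro x hx
      refine tendsto_const_nhds.congr' ?_
      filter_upwards [hev x hx] with k hk
      simp only [hφ, cutoff]
      rw [Real.smoothTransition.one_of_one_le hk.1.le, Real.smoothTransition.one_of_one_le hk.2.le]
      ring
    · intro k x hx
      have hxI := Ioo_subset_Icc_self hx
      have b1 : |(k + 1) * deriv Real.smoothTransition ((k + 1) * (x - a) - 1) * ψ x| ≤ M * M' := by
        have h1 := hLip x hxI a (left_mem_Icc.2 hab.le)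
        rw [ha, sub_zero] at h1
        calc |(k + 1) * deriv Real.smoothTransition ((k + 1) * (x - a) - 1) * ψ x|
            ≤ |(k + 1) * deriv Real.smoothTransition ((k + 1) * (x - a) - 1)| * (M * |x - a|) := by
              rw [abs_mul]; gcongr
          _ = M * |(k + 1) * (x - a) * deriv Real.smoothTransition ((k + 1) * (x - a) - 1)| := by
              simp only [abs_mul]; ring
          _ ≤ M * M' := by gcongr; exact hM' _
      have b2 : |(k + 1) * deriv Real.smoothTransition ((k + 1) * (b - x) - 1) * ψ x| ≤ M * M' := by
        have h1 := hLip x hxI b (right_mem_Icc.2 hab.le)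
        rw [hb, sub_zero, abs_sub_comm] at h1
        calc |(k + 1) * deriv Real.smoothTransition ((k + 1) * (b - x) - 1) * ψ x|
            ≤ |(k + 1) * deriv Real.smoothTransition ((k + 1) * (b - x) - 1)| * (M * |b - x|) := by
              rw [abs_mul]; gcongr
          _ = M * |(k + 1) * (b - x) * deriv Real.smoothTransition ((k + 1) * (b - x) - 1)| := by
              simp only [abs_mul]; ring
          _ ≤ M * M' := by gcongr; exact hM' _
      have e : deriv (φ k) x =
          (k + 1) * deriv Real.smoothTransition ((k + 1) * (x - a) - 1) * ψ x *
            Real.smoothTransition ((k + 1) * (b - x) - 1) -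
          (k + 1) * deriv Real.smoothTransition ((k + 1) * (b - x) - 1) * ψ x *
            Real.smoothTransition ((k + 1) * (x - a) - 1) + cutoff a b k x * deriv ψ x := by
        rw [hφ', deriv_cutoff]; ring
      rw [e]
      refine (abs_add_le _ _).trans (add_le_add ((abs_sub _ _).trans (add_le_add ?_ ?_)) ?_)
      · rw [abs_mul]; exact (mul_le_of_le_one_right (abs_nonneg _) (hT _)).trans b1
      · rw [abs_mul]; exact (mul_le_of_le_one_right (abs_nonneg _) (hT _)).trans b2
      · rw [abs_mul]
        exact (mul_le_of_le_one_left (abs_nonneg _) (hcut k x)).trans (hM x hxI)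
    · intro x hx
      refine tendsto_const_nhds.congr' ?_
      filter_upwards [hev x hx] with k hk
      rw [hφ', deriv_cutoff, cutoff, Real.smoothTransition.one_of_one_le hk.1.le,
        Real.smoothTransition.one_of_one_le hk.2.le,
        deriv_smoothTransition_eq_zero (Or.inr hk.1), deriv_smoothTransition_eq_zero (Or.inr hk.2)]
      ring
  · exact Filter.Eventually.of_forall fun k =>
      ⟨φ k, ht k, coeFn_contToL2 _ _ _ (ht k).1.continuous,
        coeFn_contToL2 _ _ _ (ht k).derivative.1.continuous⟩

theorem contDiff_sineFun (a b : ℝ) (n : ℕ) : ContDiff ℝ ∞ (sineFun a b n) := by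
  unfold sineFun; fun_prop

theorem hasDerivAt_sineFun (a b : ℝ) (n : ℕ) (x : ℝ) : HasDerivAt (sineFun a b n)
    (sineFreq a b n * (√(2 / (b - a)) * Real.cos (sineFreq a b n * (x - a)))) x := by
  have h1 : HasDerivAt (fun x : ℝ => sineFreq a b n * (x - a)) (sineFreq a b n) x := by
    simpa using ((hasDerivAt_id x).sub_const a).const_mul (sineFreq a b n)
  have := h1.sin.const_mul √(2 / (b - a))
  convert! this using 1
  ring

theorem deriv_deriv_sineFun (a b : ℝ) (n : ℕ) (x : ℝ) :
    deriv (deriv (sineFun a b n)) x = -(sineFreq a b n ^ 2 * sineFun a b n x) := by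
  have h0 : deriv (sineFun a b n) = fun x =>
      sineFreq a b n * (√(2 / (b - a)) * Real.cos (sineFreq a b n * (x - a))) :=
    funext fun x => (hasDerivAt_sineFun a b n x).deriv
  have h1 : HasDerivAt (fun x : ℝ => sineFreq a b n * (x - a)) (sineFreq a b n) x := by
    simpa using ((hasDerivAt_id x).sub_const a).const_mul (sineFreq a b n)
  rw [h0, ((h1.cos.const_mul √(2 / (b - a))).const_mul (sineFreq a b n)).deriv, sineFun]
  ring

theorem continuous_deriv_sineFun (a b : ℝ) (n : ℕ) : Continuous (deriv (sineFun a b n)) :=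
  (contDiff_sineFun a b n).continuous_deriv (by simp)

/-- The element of `L²(a, b)` given by the derivative of the `n`-th Dirichlet eigenfunction. -/
noncomputable def sineDerivL2 (a b : ℝ) (n : ℕ) : L2 (Ioo a b) :=
  contToL2 a b (deriv (sineFun a b n)) (continuous_deriv_sineFun a b n)

theorem sineFun_left (a b : ℝ) (n : ℕ) : sineFun a b n a = 0 := by simp [sineFun]

theorem sineFun_right {a b : ℝ} (hab : a < b) (n : ℕ) : sineFun a b n b = 0 := by
  have hL : b - a ≠ 0 := (sub_pos.2 hab).ne'
  have : sineFreq a b n * (b - a) = (n + 1 : ℕ) * Real.pi := by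
    unfold sineFreq; push_cast; field_simp
  simp only [sineFun, this, Real.sin_nat_mul_pi, mul_zero]

theorem sineL2_mem_H10Graph {a b : ℝ} (hab : a < b) (n : ℕ) :
    (sineL2 a b n, sineDerivL2 a b n) ∈ H10Graph (Ioo a b) :=
  contToL2_mem_H10Graph hab (contDiff_sineFun a b n) (sineFun_left a b n) (sineFun_right hab n)
    (continuous_deriv_sineFun a b n)

theorem norm_sineDerivL2_le {a b : ℝ} (hab : a < b) (n : ℕ) :
    ‖sineDerivL2 a b n‖ ≤ 2 * sineFreq a b n := by
  have hL : 0 < b - a := sub_pos.2 hab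
  have hν := sineFreq_pos hab n
  refine abs_le_of_sq_le_sq' ?_ (by positivity) |>.2
  have hcoe : sineDerivL2 a b n =ᵐ[volume.restrict (Ioo a b)] deriv (sineFun a b n) :=
    coeFn_contToL2 _ _ _ _
  rw [← real_inner_self_eq_norm_sq, L2_inner_eq_integral _ _ hcoe hcoe]
  have hb : ∀ x, deriv (sineFun a b n) x * deriv (sineFun a b n) x ≤
      sineFreq a b n ^ 2 * (2 / (b - a)) := by
    intro x
    rw [(hasDerivAt_sineFun a b n x).deriv]
    have h3 : √(2 / (b - a)) ^ 2 = 2 / (b - a) := Real.sq_sqrt (by positivity)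
    calc _ = sineFreq a b n ^ 2 * (√(2 / (b - a)) ^ 2 *
          Real.cos (sineFreq a b n * (x - a)) ^ 2) := by ring
      _ ≤ sineFreq a b n ^ 2 * ((2 / (b - a)) * 1) := by
          rw [h3]; gcongr; exact Real.cos_sq_le_one _
      _ = _ := by ring
  calc ∫ x in Ioo a b, deriv (sineFun a b n) x * deriv (sineFun a b n) x
      ≤ ∫ x in Ioo a b, sineFreq a b n ^ 2 * (2 / (b - a)) := by
        refine integral_mono_of_nonneg (Filter.Eventually.of_forall fun x => mul_self_nonneg _)
          (integrable_const _) (Filter.Eventually.of_forall hb)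
    _ = 2 * sineFreq a b n ^ 2 := by
        simp [hab.le]
        field_simp
    _ ≤ (2 * sineFreq a b n) ^ 2 := by nlinarith [sq_nonneg (sineFreq a b n)]

/-- Integration by parts twice against a test function. -/
theorem integral_mul_deriv_deriv_test {Ω : Set ℝ} {F φ : ℝ → ℝ} (hF : ContDiff ℝ ∞ F)
    (hφ : IsTestFunction Ω φ) :
    ∫ x in Ω, F x * deriv (deriv φ) x = ∫ x in Ω, deriv (deriv F) x * φ x := by
  have hF' : ContDiff ℝ ∞ (deriv F) := (contDiff_infty_iff_deriv.1 hF).2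
  have hF'' : ContDiff ℝ ∞ (deriv (deriv F)) := (contDiff_infty_iff_deriv.1 hF').2
  have hi : ∀ {G χ : ℝ → ℝ}, Continuous G → IsTestFunction Ω χ → Integrable (G * χ) :=
    fun {G χ} hG hχ =>
      (hG.mul hχ.1.continuous).integrable_of_hasCompactSupport hχ.2.1.mul_left
  have hset : ∀ {G χ : ℝ → ℝ}, IsTestFunction Ω χ →
      ∫ x in Ω, G x * χ x = ∫ x, G x * χ x := fun {G χ} hχ =>
    setIntegral_eq_integral_of_forall_compl_eq_zero fun x hx => by
      rw [image_eq_zero_of_notMem_tsupport fun hh => hx (hχ.2.2 hh), mul_zero]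
  have hφ' := hφ.derivative
  have hφ'' := hφ'.derivative
  have dF : ∀ x, HasDerivAt F (deriv F x) x := fun x =>
    (hF.differentiable (by simp) x).hasDerivAt
  have dF' : ∀ x, HasDerivAt (deriv F) (deriv (deriv F) x) x := fun x =>
    (hF'.differentiable (by simp) x).hasDerivAt
  have dφ : ∀ x, HasDerivAt φ (deriv φ x) x := fun x => (hφ.differentiable x).hasDerivAt
  have dφ' : ∀ x, HasDerivAt (deriv φ) (deriv (deriv φ) x) x := fun x =>
    (hφ'.differentiable x).hasDerivAt
  rw [hset hφ'', hset hφ,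
    integral_mul_deriv_eq_deriv_mul_of_integrable (u := F) (v := deriv φ) (fun x _ => dF x)
      (fun x _ => dφ' x)
      (hi hF.continuous hφ'') (hi hF'.continuous hφ') (hi hF.continuous hφ'),
    integral_mul_deriv_eq_deriv_mul_of_integrable (u := deriv F) (v := φ) (fun x _ => dF' x)
      (fun x _ => dφ x)
      (hi hF'.continuous hφ') (hi hF''.continuous hφ) (hi hF'.continuous hφ), neg_neg]

theorem sineL2_mem_dirichletGraph {a b : ℝ} (hab : a < b) (n : ℕ) :
    (sineL2 a b n, (sineFreq a b n ^ 2) • sineL2 a b n) ∈ dirichletGraph (Ioo a b) := by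
  refine ⟨⟨_, sineL2_mem_H10Graph hab n, rfl⟩, fun φ hφ => ?_⟩
  have h1 : ∫ x in Ioo a b, sineL2 a b n x * deriv (deriv φ) x =
      ∫ x in Ioo a b, sineFun a b n x * deriv (deriv φ) x := by
    refine integral_congr_ae ?_
    filter_upwards [coeFn_sineL2 a b n] with x hx
    rw [hx]
  have h2 : ∫ x in Ioo a b, ((sineFreq a b n ^ 2) • sineL2 a b n : L2 (Ioo a b)) x * φ x =
      ∫ x in Ioo a b, -(deriv (deriv (sineFun a b n)) x * φ x) := by
    refine integral_congr_ae ?_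
    filter_upwards [coeFn_sineL2 a b n, Lp.coeFn_smul (sineFreq a b n ^ 2) (sineL2 a b n)]
      with x hx hx'
    rw [hx', Pi.smul_apply, hx, deriv_deriv_sineFun, smul_eq_mul]
    ring
  change ∫ x in Ioo a b, sineL2 a b n x * deriv (deriv φ) x = -∫ x in Ioo a b,
    ((sineFreq a b n ^ 2) • sineL2 a b n : L2 (Ioo a b)) x * φ x
  rw [h1, h2, integral_neg, neg_neg, integral_mul_deriv_deriv_test (contDiff_sineFun a b n) hφ]

/-- The graph of the Dirichlet Laplacian is stable under convergent series, as soon as the first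
components sum to an element of `H¹₀`. -/
theorem mem_dirichletGraph_of_hasSum {Ω : Set ℝ} {f g : ℕ → L2 Ω} {F G : L2 Ω}
    (hfg : ∀ n, (f n, g n) ∈ dirichletGraph Ω) (hf : HasSum f F) (hg : HasSum g G)
    (hF : F ∈ H10 Ω) : (F, G) ∈ dirichletGraph Ω := by
  refine ⟨hF, fun φ hφ => ?_⟩
  have key : ∀ (χ : ℝ → ℝ) (hχ : IsTestFunction Ω χ) (w : L2 Ω),
      ∫ x in Ω, w x * χ x = inner ℝ hχ.memLp.toLp w := by
    intro χ hχ w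
    rw [L2_inner_eq_integral _ _ hχ.memLp.coeFn_toLp Filter.EventuallyEq.rfl]
  change ∫ x in Ω, F x * deriv (deriv φ) x = -∫ x in Ω, G x * φ x
  have h : ∀ n, inner ℝ hφ.derivative.derivative.memLp.toLp (f n) =
      -inner ℝ hφ.memLp.toLp (g n) := by
    intro n
    rw [← key _ hφ.derivative.derivative, ← key _ hφ]
    exact (hfg n).2 φ hφ
  rw [key _ hφ.derivative.derivative, key _ hφ]
  have h1 := hf.mapL (innerSL ℝ hφ.derivative.derivative.memLp.toLp)
  have h2 := (hg.mapL (innerSL ℝ hφ.memLp.toLp)).neg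
  simp only [innerSL_apply_apply, h] at h1 h2
  exact h1.unique h2

theorem mem_H10Graph_of_hasSum {Ω : Set ℝ} {f : ℕ → L2 Ω × L2 Ω} {F : L2 Ω × L2 Ω}
    (hf : ∀ n, f n ∈ H10Graph Ω) (h : HasSum f F) : F ∈ H10Graph Ω :=
  (Submodule.isClosed_topologicalClosure _).mem_of_tendsto h
    (Filter.Eventually.of_forall fun _ => Submodule.sum_mem _ fun n _ => hf n)

/-! ### Superpositions of damped modes -/

/-- The real part of the damped mode with weight `w` and exponent `m`. The time origin is moved
to `t = -1`, so that exponential decay makes all series of modes converge near `[0, ∞)`. -/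
noncomputable def modalCoef (m w : ℕ → ℂ) (n : ℕ) (t : ℝ) : ℝ :=
  (w n * Complex.exp (m n * ((t + 1 : ℝ) : ℂ))).re

/-- The superposition of the modes `modalCoef m w n` carried by the vectors `E n`. -/
noncomputable def modalSeries {H : Type*} [NormedAddCommGroup H] [NormedSpace ℝ H]
    (E : ℕ → H) (m w : ℕ → ℂ) (t : ℝ) : H :=
  ∑' n, modalCoef m w n t • E n

theorem hasDerivAt_modalCoef (m w : ℕ → ℂ) (n : ℕ) (t : ℝ) :
    HasDerivAt (modalCoef m w n) (modalCoef m (fun n => w n * m n) n t) t := by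
  have h1 : HasDerivAt (fun t : ℝ => ((t + 1 : ℝ) : ℂ)) 1 t := by
    simpa using ((hasDerivAt_id t).add_const 1).ofReal_comp
  have h2 := ((h1.const_mul (m n)).cexp).const_mul (w n)
  have h3 := Complex.reCLM.hasFDerivAt.comp_hasDerivAt t h2
  convert! h3 using 1
  simp only [modalCoef, Complex.reCLM_apply]
  congr 1
  ring

theorem abs_modalCoef_le (m w : ℕ → ℂ) (n : ℕ) (t : ℝ) :
    |modalCoef m w n t| ≤ ‖w n‖ * Real.exp ((m n).re * (t + 1)) := by
  refine (Complex.abs_re_le_norm _).trans ?_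
  rw [norm_mul, Complex.norm_exp, Complex.re_mul_ofReal]

theorem abs_modalCoef_le_of_lt {m w : ℕ → ℂ} (hre : ∀ n, w n ≠ 0 → (m n).re ≤ 0) (n : ℕ) {t : ℝ}
    (ht : -1 / 2 < t) : |modalCoef m w n t| ≤ ‖w n‖ * Real.exp ((m n).re / 2) := by
  by_cases hw : w n = 0
  · simp [modalCoef, hw]
  · refine (abs_modalCoef_le m w n t).trans ?_
    gcongr
    nlinarith [hre n hw]

section modal

variable {H : Type*} [NormedAddCommGroup H] [NormedSpace ℝ H] [CompleteSpace H]

theorem hasSum_modalSeries {E : ℕ → H} {m w : ℕ → ℂ} (hre : ∀ n, w n ≠ 0 → (m n).re ≤ 0)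
    (h : Summable fun n => ‖w n‖ * Real.exp ((m n).re / 2) * ‖E n‖) {t : ℝ} (ht : -1 / 2 < t) :
    HasSum (fun n => modalCoef m w n t • E n) (modalSeries E m w t) := by
  refine (Summable.of_norm_bounded h fun n => ?_).hasSum
  rw [norm_smul]
  exact mul_le_mul_of_nonneg_right (abs_modalCoef_le_of_lt hre n ht) (norm_nonneg _)

theorem hasDerivAt_modalSeries {E : ℕ → H} {m w : ℕ → ℂ} (hre : ∀ n, w n ≠ 0 → (m n).re ≤ 0)
    (h : Summable fun n => ‖w n‖ * Real.exp ((m n).re / 2) * ‖E n‖)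
    (h' : Summable fun n => ‖w n * m n‖ * Real.exp ((m n).re / 2) * ‖E n‖) {t : ℝ}
    (ht : -1 / 2 < t) :
    HasDerivAt (modalSeries E m w) (modalSeries E m (fun n => w n * m n) t) t := by
  refine hasDerivAt_tsum_of_isPreconnected h' isOpen_Ioi isPreconnected_Ioi
    (g := fun n t => modalCoef m w n t • E n) (t := Ioi (-1 / 2)) (y₀ := t)
    (g' := fun n t => modalCoef m (fun n => w n * m n) n t • E n) ?_ ?_ ht
    (hasSum_modalSeries hre h ht).summable ht
  · intro n s _
    exact (hasDerivAt_modalCoef m w n s).smul_const (E n)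
  · intro n s hs
    rw [norm_smul]
    exact mul_le_mul_of_nonneg_right
      (abs_modalCoef_le_of_lt (fun n hn => hre n (left_ne_zero_of_mul hn)) n hs) (norm_nonneg _)

end modal

/-- A root of `x² + c λ^α x + λ` grows at most like `λ`. -/
theorem norm_root_le {α c ν : ℝ} (hα0 : 0 < α) (hα1 : α < 1) (hc : 0 < c) (hν : 0 < ν) {m : ℂ}
    (hm : m ^ 2 + ((c * (ν ^ 2) ^ α : ℝ) : ℂ) * m + ((ν ^ 2 : ℝ) : ℂ) = 0) :
    (ν ^ 2) ^ α ≤ (1 + ν) ^ 2 ∧ ‖m‖ ≤ (c + 2) * (1 + ν) ^ 2 := by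
  have h1 : (ν ^ 2) ^ α ≤ (1 + ν) ^ 2 := by
    calc (ν ^ 2) ^ α ≤ ((1 + ν) ^ 2) ^ α := by
          apply Real.rpow_le_rpow (by positivity) _ hα0.le
          gcongr; linarith
      _ ≤ ((1 + ν) ^ 2) ^ (1 : ℝ) :=
          Real.rpow_le_rpow_of_exponent_le (one_le_pow₀ (by linarith)) hα1.le
      _ = _ := Real.rpow_one _
  refine ⟨h1, ?_⟩
  have hp : (0 : ℝ) ≤ (ν ^ 2) ^ α := by positivity
  rcases le_total ‖m‖ 1 with h | h
  · have : (1 : ℝ) ≤ (1 + ν) ^ 2 := one_le_pow₀ (by linarith)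
    nlinarith
  · have h2 : ‖m‖ ^ 2 ≤ c * (ν ^ 2) ^ α * ‖m‖ + ν ^ 2 := by
      have : m ^ 2 = -(((c * (ν ^ 2) ^ α : ℝ) : ℂ) * m + ((ν ^ 2 : ℝ) : ℂ)) := by
        linear_combination hm
      rw [← norm_pow, this, norm_neg]
      refine (norm_add_le _ _).trans ?_
      rw [norm_mul, Complex.norm_real, Complex.norm_real, Real.norm_of_nonneg (by positivity),
        Real.norm_of_nonneg (by positivity)]
    have h3 : ‖m‖ * ‖m‖ ≤ (c * (ν ^ 2) ^ α + ν ^ 2) * ‖m‖ := by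
      nlinarith [mul_nonneg (sq_nonneg ν) (sub_nonneg.2 h)]
    have h4 := le_of_mul_le_mul_right h3 (by linarith)
    nlinarith [mul_le_mul_of_nonneg_left h1 hc.le]

theorem isDampedWaveSolution_modalSeries {a b : ℝ} (hab : a < b) {α c : ℝ} (hα0 : 0 < α)
    (hα1 : α < 1) (hc : 0 < c) {m w : ℕ → ℂ}
    (hroot : ∀ n, w n ≠ 0 → m n ^ 2 + ((c * (sineFreq a b n ^ 2) ^ α : ℝ) : ℂ) * m n +
      ((sineFreq a b n ^ 2 : ℝ) : ℂ) = 0)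
    (hre : ∀ n, w n ≠ 0 → (m n).re ≤ 0)
    (hsum : ∀ k : ℕ, Summable fun n =>
      ‖w n‖ * (1 + sineFreq a b n) ^ k * Real.exp ((m n).re / 2)) :
    IsDampedWaveSolution (Ioo a b) α c (modalSeries (sineL2 a b) m w 0)
      (modalSeries (sineL2 a b) m (fun n => w n * m n) 0) (modalSeries (sineL2 a b) m w) := by
  set ν := sineFreq a b with hνdef
  have hν : ∀ n, 0 < ν n := sineFreq_pos hab
  have hnorm : ∀ n, ‖sineL2 a b n‖ = 1 := fun n => (orthonormal_sineL2 hab).1 n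
  have hm : ∀ n, w n ≠ 0 → (ν n ^ 2) ^ α ≤ (1 + ν n) ^ 2 ∧ ‖m n‖ ≤ (c + 2) * (1 + ν n) ^ 2 :=
    fun n hn => norm_root_le hα0 hα1 hc (hν n) (hroot n hn)
  -- Every series below has weights at most polynomially larger than `w`.
  have hS : ∀ (E : ℕ → L2 (Ioo a b)) (w' : ℕ → ℂ) (K : ℝ) (k : ℕ),
      (∀ n, w n = 0 → w' n = 0) → (∀ n, w n ≠ 0 → ‖w' n‖ * ‖E n‖ ≤ K * (‖w n‖ * (1 + ν n) ^ k)) →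
      Summable fun n => ‖w' n‖ * Real.exp ((m n).re / 2) * ‖E n‖ := by
    intro E w' K k h0 h
    refine Summable.of_nonneg_of_le (fun n => by positivity) (fun n => ?_) ((hsum k).mul_left K)
    by_cases hn : w n = 0
    · simp [hn, h0 n hn]
    · calc ‖w' n‖ * Real.exp ((m n).re / 2) * ‖E n‖
          = (‖w' n‖ * ‖E n‖) * Real.exp ((m n).re / 2) := by ring
        _ ≤ (K * (‖w n‖ * (1 + ν n) ^ k)) * Real.exp ((m n).re / 2) := by
            exact mul_le_mul_of_nonneg_right (h n hn) (Real.exp_pos _).le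
        _ = _ := by ring
  have hre' : ∀ w' : ℕ → ℂ, (∀ n, w n = 0 → w' n = 0) → ∀ n, w' n ≠ 0 → (m n).re ≤ 0 :=
    fun w' h0 n hn => hre n fun h => hn (h0 n h)
  have z1 : ∀ n, w n = 0 → w n * m n = 0 := fun n h => by simp [h]
  have z2 : ∀ n, w n = 0 → w n * m n * m n = 0 := fun n h => by simp [h]
  have z3 : ∀ n, w n = 0 → ((ν n ^ 2 : ℝ) : ℂ) * w n = 0 := fun n h => by simp [h]
  have z4 : ∀ n, w n = 0 → (((ν n ^ 2) ^ α : ℝ) : ℂ) * (w n * m n) = 0 := fun n h => by simp [h]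
  have s0 := hS (sineL2 a b) w 1 0 (fun _ h => h) fun n _ => by simp [hnorm]
  have s1 := hS (sineL2 a b) (fun n => w n * m n) (c + 2) 2 z1 fun n hn => by
    rw [hnorm, mul_one, norm_mul]
    nlinarith [mul_le_mul_of_nonneg_left (hm n hn).2 (norm_nonneg (w n))]
  have s2 := hS (sineL2 a b) (fun n => w n * m n * m n) ((c + 2) ^ 2) 4 z2 fun n hn => by
    rw [hnorm, mul_one, norm_mul, norm_mul]
    calc ‖w n‖ * ‖m n‖ * ‖m n‖ ≤
          ‖w n‖ * ((c + 2) * (1 + ν n) ^ 2) * ((c + 2) * (1 + ν n) ^ 2) := by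
          gcongr <;> exact (hm n hn).2
      _ = _ := by ring
  have s3 := hS (sineL2 a b) (fun n => ((ν n ^ 2 : ℝ) : ℂ) * w n) 1 2 z3 fun n hn => by
    rw [hnorm, mul_one, norm_mul, Complex.norm_real, Real.norm_of_nonneg (by positivity), one_mul,
      mul_comm]
    exact mul_le_mul_of_nonneg_left (pow_le_pow_left₀ (hν n).le (by linarith) 2) (norm_nonneg _)
  have s4 := hS (sineL2 a b) (fun n => (((ν n ^ 2) ^ α : ℝ) : ℂ) * (w n * m n)) (c + 2) 4 z4
    fun n hn => by
      rw [hnorm, mul_one, norm_mul, norm_mul, Complex.norm_real,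
        Real.norm_of_nonneg (by positivity)]
      calc (ν n ^ 2) ^ α * (‖w n‖ * ‖m n‖) ≤
            (1 + ν n) ^ 2 * (‖w n‖ * ((c + 2) * (1 + ν n) ^ 2)) := by
            gcongr
            · exact (hm n hn).1
            · exact (hm n hn).2
        _ = _ := by ring
  have d0 := hS (sineDerivL2 a b) w 2 1 (fun _ h => h) fun n _ => by
    calc ‖w n‖ * ‖sineDerivL2 a b n‖ ≤ ‖w n‖ * (2 * (1 + ν n)) := by
          gcongr
          exact (norm_sineDerivL2_le hab n).trans (by linarith)
      _ = _ := by ring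
  have d1 := hS (sineDerivL2 a b) (fun n => w n * m n) (2 * (c + 2)) 3 z1 fun n hn => by
    rw [norm_mul]
    calc ‖w n‖ * ‖m n‖ * ‖sineDerivL2 a b n‖ ≤
          ‖w n‖ * ((c + 2) * (1 + ν n) ^ 2) * (2 * (1 + ν n)) := by
          gcongr
          · exact (hm n hn).2
          · exact (norm_sineDerivL2_le hab n).trans (by linarith)
      _ = _ := by ring
  have hgraph : ∀ t, -1 / 2 < t →
      (modalSeries (sineL2 a b) m w t, modalSeries (sineDerivL2 a b) m w t) ∈
        H10Graph (Ioo a b) := fun t ht =>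
    mem_H10Graph_of_hasSum
      (fun n => (H10Graph (Ioo a b)).smul_mem (modalCoef m w n t) (sineL2_mem_H10Graph hab n))
      ((hasSum_modalSeries hre s0 ht).prodMk (hasSum_modalSeries hre d0 ht))
  have hder0 : ∀ t, -1 / 2 < t → HasDerivAt (modalSeries (sineL2 a b) m w)
      (modalSeries (sineL2 a b) m (fun n => w n * m n) t) t := fun t ht =>
    hasDerivAt_modalSeries hre s0 s1 ht
  have hder1 : ∀ t, -1 / 2 < t → HasDerivAt (modalSeries (sineL2 a b) m (fun n => w n * m n))
      (modalSeries (sineL2 a b) m (fun n => w n * m n * m n) t) t := fun t ht =>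
    hasDerivAt_modalSeries (hre' _ z1) s1 s2 ht
  have hpos : ∀ t : ℝ, 0 ≤ t → -1 / 2 < t := fun t ht => by linarith
  refine ⟨⟨modalSeries (sineDerivL2 a b) m w, ?_, fun t ht => hgraph t (hpos t ht)⟩, rfl,
    modalSeries (sineL2 a b) m (fun n => w n * m n), ?_, rfl, ?_, ?_⟩
  · intro t ht
    exact ((hder0 t (hpos t ht)).continuousAt.prodMk
      (hasDerivAt_modalSeries hre d0 d1 (hpos t ht)).continuousAt).continuousWithinAt
  · intro t ht
    exact (hder1 t (hpos t ht)).continuousAt.continuousWithinAt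
  · intro t ht
    exact (hder0 t (hpos t ht)).hasDerivWithinAt
  · intro t ht
    have ht' := hpos t ht.le
    have S0 := hasSum_modalSeries hre s0 ht'
    have S1 := hasSum_modalSeries (hre' _ z1) s1 ht'
    have S2 := hasSum_modalSeries (hre' _ z2) s2 ht'
    have S3 := hasSum_modalSeries (hre' _ z3) s3 ht'
    have S4 := hasSum_modalSeries (hre' _ z4) s4 ht'
    refine ⟨modalSeries (sineL2 a b) m (fun n => ((ν n ^ 2 : ℝ) : ℂ) * w n) t,
      modalSeries (sineL2 a b) m (fun n => (((ν n ^ 2) ^ α : ℝ) : ℂ) * (w n * m n)) t, _, ?_,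
      ⟨sineBasis hab, fun n => ν n ^ 2, fun n => ⟨by positivity, ?_⟩, ?_⟩, hder1 t ht', ?_⟩
    · rw [dirichletLaplacian_graph isOpen_Ioo]
      refine mem_dirichletGraph_of_hasSum (fun n => ?_) S0 S3 ⟨_, hgraph t ht', rfl⟩
      have h := (dirichletGraph (Ioo a b)).smul_mem (modalCoef m w n t)
        (sineL2_mem_dirichletGraph hab n)
      convert! h using 2
      simp only [Prod.smul_mk, smul_smul, modalCoef, mul_assoc, Complex.re_ofReal_mul]
      rw [mul_comm]
    · rw [dirichletLaplacian_graph isOpen_Ioo, coe_sineBasis]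
      exact sineL2_mem_dirichletGraph hab n
    · have hin : ∀ n, inner ℝ (sineL2 a b n)
          (modalSeries (sineL2 a b) m (fun n => w n * m n) t) =
          modalCoef m (fun n => w n * m n) n t := by
        intro n
        have h1 := S1.mapL (innerSL ℝ (sineL2 a b n))
        simp only [innerSL_apply_apply, inner_smul_right,
          orthonormal_iff_ite.1 (orthonormal_sineL2 hab), mul_ite, mul_one, mul_zero] at h1
        have h2 := hasSum_single
          (f := fun k => if n = k then modalCoef m (fun n => w n * m n) k t else 0) n
          fun k hk => if_neg hk.symm
        simp only [if_true] at h2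
        exact h1.unique h2
      simp only [coe_sineBasis, hin]
      convert! S4 using 2 with n
      simp only [modalCoef]
      rw [mul_assoc ((((ν n ^ 2) ^ α : ℝ) : ℂ)), Complex.re_ofReal_mul]
    · -- Mode by mode the equation is the characteristic equation.
      have hS := (S2.add S3).add (S4.const_smul c)
      refine hS.unique ?_
      convert! hasSum_zero using 2 with n
      rw [smul_smul, ← add_smul, ← add_smul]
      convert! zero_smul ℝ (sineL2 a b n) using 2
      by_cases hn : w n = 0
      · simp [modalCoef, hn]
      · simp only [modalCoef]
        rw [← Complex.re_ofReal_mul, ← Complex.add_re, ← Complex.add_re]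
        have := hroot n hn
        convert! Complex.zero_re using 2
        rw [Complex.ofReal_mul] at this
        linear_combination (w n * Complex.exp (m n * ((t + 1 : ℝ) : ℂ))) * this

/-! ### The characteristic roots -/

/-- The root of `x² + 2Px + ν²` of largest real part and nonnegative imaginary part. -/
noncomputable def charRoot (P ν : ℝ) : ℂ :=
  if ν ≤ P then ((-P + √(P ^ 2 - ν ^ 2) : ℝ) : ℂ) else ⟨-P, √(ν ^ 2 - P ^ 2)⟩

theorem charRoot_isRoot {P ν : ℝ} (hP : 0 ≤ P) (hν : 0 ≤ ν) :
    charRoot P ν ^ 2 + ((2 * P : ℝ) : ℂ) * charRoot P ν + ((ν ^ 2 : ℝ) : ℂ) = 0 := by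
  unfold charRoot
  split_ifs with h
  · have : √(P ^ 2 - ν ^ 2) ^ 2 = P ^ 2 - ν ^ 2 := Real.sq_sqrt (by nlinarith)
    norm_cast
    nlinarith
  · have : √(ν ^ 2 - P ^ 2) ^ 2 = ν ^ 2 - P ^ 2 := Real.sq_sqrt (by nlinarith)
    apply Complex.ext
    · simp only [pow_two] at this
      simp [pow_two]
      linarith
    · simp [pow_two]
      ring

theorem charRoot_overdamped {P ν : ℝ} (hν : 0 < ν) (h : ν ≤ P) :
    (charRoot P ν).im = 0 ∧ ν ^ 2 / (2 * P) ≤ -(charRoot P ν).re ∧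
      -(charRoot P ν).re ≤ ν ^ 2 / P := by
  have hP : 0 < P := hν.trans_le h
  have h1 : √(P ^ 2 - ν ^ 2) ^ 2 = P ^ 2 - ν ^ 2 := Real.sq_sqrt (by nlinarith)
  have h0 := Real.sqrt_nonneg (P ^ 2 - ν ^ 2)
  have h2 : √(P ^ 2 - ν ^ 2) ≤ P := Real.sqrt_le_iff.2 ⟨hP.le, by nlinarith⟩
  rw [charRoot, if_pos h]
  refine ⟨Complex.ofReal_im _, ?_, ?_⟩
  · rw [Complex.ofReal_re, div_le_iff₀ (by positivity)]
    nlinarith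
  · rw [Complex.ofReal_re, le_div_iff₀ hP]
    nlinarith

theorem charRoot_underdamped {P ν : ℝ} (h : P < ν) :
    (charRoot P ν).re = -P ∧ (charRoot P ν).im = √(ν ^ 2 - P ^ 2) := by
  rw [charRoot, if_neg h.not_ge]
  exact ⟨rfl, rfl⟩

theorem tendsto_sineFreq {a b : ℝ} (hab : a < b) :
    Filter.Tendsto (sineFreq a b) Filter.atTop Filter.atTop := by
  have hL := sub_pos.2 hab
  have h := ((tendsto_natCast_atTop_atTop (R := ℝ)).atTop_add
    (tendsto_const_nhds (x := (1 : ℝ)))).atTop_mul_const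
    (show 0 < Real.pi / (b - a) by positivity)
  refine h.congr fun n => ?_
  unfold sineFreq; ring

theorem sineFreq_succ (a b : ℝ) (n : ℕ) :
    sineFreq a b (n + 1) = sineFreq a b n + Real.pi / (b - a) := by
  unfold sineFreq; push_cast; ring

/-- Frequencies `ω = √(ν² - P²)` with `P = qν`, `P` increasing and `q` decreasing: the gap between
two consecutive ones is close to the gap `h` of the undamped frequencies. -/
theorem damped_freq_gap {ν h P P' q s : ℝ} (hν : 0 < ν) (hh : 0 < h) (hP : 0 ≤ P) (hPP : P ≤ P')
    (hq : P = q * ν) (hq' : P' ≤ q * (ν + h)) (hs0 : 0 < s) (hs : s ^ 2 = 1 - q ^ 2) :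
    s ^ 2 * h ≤ √((ν + h) ^ 2 - P' ^ 2) - √(ν ^ 2 - P ^ 2) ∧
      √((ν + h) ^ 2 - P' ^ 2) - √(ν ^ 2 - P ^ 2) ≤ h / s := by
  have e : √(ν ^ 2 - P ^ 2) = s * ν := by
    rw [hq, show ν ^ 2 - (q * ν) ^ 2 = (s * ν) ^ 2 by rw [mul_pow s, hs]; ring]
    exact Real.sqrt_sq (by positivity)
  have hPsq : P ^ 2 ≤ P' ^ 2 := pow_le_pow_left₀ hP hPP 2
  have hPsq' : P' ^ 2 ≤ (q * (ν + h)) ^ 2 := pow_le_pow_left₀ (hP.trans hPP) hq' 2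
  have hlow : s * (ν + h) ≤ √((ν + h) ^ 2 - P' ^ 2) := by
    refine Real.le_sqrt_of_sq_le ?_
    rw [mul_pow, hs]; nlinarith
  have hup : √((ν + h) ^ 2 - P' ^ 2) ≤ ν + h :=
    Real.sqrt_le_iff.2 ⟨by positivity, by nlinarith [sq_nonneg P']⟩
  have hsq : √((ν + h) ^ 2 - P' ^ 2) ^ 2 = (ν + h) ^ 2 - P' ^ 2 := by
    refine Real.sq_sqrt ?_
    have : 0 ≤ (s * (ν + h)) ^ 2 := sq_nonneg _
    rw [mul_pow, hs] at this; nlinarith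
  have hs1 : s ≤ 1 := by nlinarith [sq_nonneg q]
  rw [e]
  set y := √((ν + h) ^ 2 - P' ^ 2)
  have hPe : P ^ 2 = (1 - s ^ 2) * ν ^ 2 := by rw [hq, hs]; ring
  have hsum : 0 < y + s * ν := by positivity
  constructor
  · -- `s² h (y + sν) ≤ s² h (2ν + h) ≤ y² - s²ν²`
    have h1 : s ^ 2 * h * (y + s * ν) ≤ (y - s * ν) * (y + s * ν) := by
      have h2 : s ^ 2 * h * (y + s * ν) ≤ s ^ 2 * h * (2 * ν + h) := by
        exact mul_le_mul_of_nonneg_left (by nlinarith) (by positivity)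
      have h3 : (q * (ν + h)) ^ 2 = (1 - s ^ 2) * (ν + h) ^ 2 := by rw [hs]; ring
      nlinarith
    exact le_of_mul_le_mul_right h1 hsum
  · rw [le_div_iff₀ hs0]
    have h1 : (y - s * ν) * s * (2 * ν + h) ≤ h * (2 * ν + h) := by
      have h2 : 0 ≤ y - s * ν := by nlinarith
      have h3 : (y - s * ν) * (s * (2 * ν + h)) ≤ (y - s * ν) * (y + s * ν) :=
        mul_le_mul_of_nonneg_left (by nlinarith) h2
      nlinarith
    exact le_of_mul_le_mul_right h1 (by positivity)

/-- Half the damping coefficient of the `n`-th mode. -/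
noncomputable def halfDamping (a b α c : ℝ) (n : ℕ) : ℝ := c / 2 * (sineFreq a b n ^ 2) ^ α

theorem halfDamping_eq {a b : ℝ} (hab : a < b) (α c : ℝ) (n : ℕ) :
    halfDamping a b α c n = c / 2 * sineFreq a b n ^ (2 * α) := by
  rw [halfDamping, ← Real.rpow_natCast_mul (sineFreq_pos hab n).le]; norm_num

theorem halfDamping_eq_mul {a b : ℝ} (hab : a < b) (α c : ℝ) (n : ℕ) :
    halfDamping a b α c n = c / 2 * sineFreq a b n ^ (2 * α - 1) * sineFreq a b n := by
  rw [halfDamping_eq hab, Real.rpow_sub_one (sineFreq_pos hab n).ne']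
  field_simp [(sineFreq_pos hab n).ne']

/-- The slow characteristic roots: they satisfy the characteristic equation, their decay rates are
of the order of `λ^β` with `β = min α (1 - α)`, and the gaps of their imaginary parts converge. -/
theorem exists_charRoots {a b : ℝ} (hab : a < b) {α c : ℝ} (hα0 : 0 < α) (hα1 : α < 1)
    (hc : 0 < c) : ∃ (m : ℕ → ℂ) (n₀ : ℕ) (κ₁ κ₂ δ : ℝ), 0 < κ₁ ∧ 0 < κ₂ ∧
      (∀ n, m n ^ 2 + ((c * (sineFreq a b n ^ 2) ^ α : ℝ) : ℂ) * m n +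
        ((sineFreq a b n ^ 2 : ℝ) : ℂ) = 0) ∧
      (∀ n, n₀ ≤ n → κ₁ * sineFreq a b n ^ (2 * min α (1 - α)) ≤ -(m n).re ∧
        -(m n).re ≤ κ₂ * sineFreq a b n ^ (2 * min α (1 - α))) ∧
      Filter.Tendsto (fun n => (m (n + 1)).im - (m n).im) Filter.atTop (nhds δ) := by
  have hL := sub_pos.2 hab
  set ν := sineFreq a b with hνdef
  set P := halfDamping a b α c with hPdef
  have hν : ∀ n, 0 < ν n := sineFreq_pos hab
  have hP : ∀ n, 0 < P n := fun n => by
    have := hν n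
    rw [hPdef, halfDamping_eq hab]; positivity
  have hroot : ∀ n, charRoot (P n) (ν n) ^ 2 + ((c * (ν n ^ 2) ^ α : ℝ) : ℂ) * charRoot (P n) (ν n)
      + ((ν n ^ 2 : ℝ) : ℂ) = 0 := fun n => by
    have e : c * (ν n ^ 2) ^ α = 2 * P n := by rw [hPdef, halfDamping]; ring
    rw [e]
    exact charRoot_isRoot (hP n).le (hν n).le
  have hPe : ∀ n, P n = c / 2 * ν n ^ (2 * α) := fun n => halfDamping_eq hab α c n
  have hPq : ∀ n, P n = c / 2 * ν n ^ (2 * α - 1) * ν n := fun n => halfDamping_eq_mul hab α c n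
  have hsucc : ∀ n, ν (n + 1) = ν n + Real.pi / (b - a) := sineFreq_succ a b
  have hπ : 0 < Real.pi / (b - a) := by positivity
  -- Overdamped high modes.
  have h_over : 1 / 2 ≤ α → (∀ᶠ n in Filter.atTop, ν n ≤ P n) → ∃ (m : ℕ → ℂ) (n₀ : ℕ)
      (κ₁ κ₂ δ : ℝ), 0 < κ₁ ∧ 0 < κ₂ ∧ (∀ n, m n ^ 2 + ((c * (ν n ^ 2) ^ α : ℝ) : ℂ) * m n +
        ((ν n ^ 2 : ℝ) : ℂ) = 0) ∧ (∀ n, n₀ ≤ n → κ₁ * ν n ^ (2 * min α (1 - α)) ≤ -(m n).re ∧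
        -(m n).re ≤ κ₂ * ν n ^ (2 * min α (1 - α))) ∧
      Filter.Tendsto (fun n => (m (n + 1)).im - (m n).im) Filter.atTop (nhds δ) := by
    intro hα hev
    obtain ⟨n₀, hn₀⟩ := Filter.eventually_atTop.1 hev
    refine ⟨fun n => charRoot (P n) (ν n), n₀, 1 / c, 2 / c, 0, by positivity, by positivity,
      hroot, fun n hn => ?_, ?_⟩
    · have h := charRoot_overdamped (hν n) (hn₀ n hn)
      have e : ν n ^ 2 / P n = 2 / c * ν n ^ (2 * (1 - α)) := by
        rw [hPe, show 2 * (1 - α) = (2 : ℕ) - 2 * α by push_cast; ring, Real.rpow_sub (hν n),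
          Real.rpow_natCast]
        field_simp
      rw [min_eq_right (by linarith)]
      refine ⟨?_, h.2.2.trans e.le⟩
      refine le_trans (le_of_eq ?_) h.2.1
      rw [mul_comm 2 (P n), ← div_div, e]; ring
    · refine tendsto_const_nhds.congr' ?_
      filter_upwards [Filter.eventually_ge_atTop n₀] with n hn
      rw [(charRoot_overdamped (hν n) (hn₀ n hn)).1,
        (charRoot_overdamped (hν (n + 1)) (hn₀ (n + 1) (by omega))).1, sub_zero]
  -- Underdamped high modes.
  have h_under : α ≤ 1 / 2 → (∀ᶠ n in Filter.atTop, P n < ν n) → (∃ δ, Filter.Tendsto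
      (fun n => √(ν (n + 1) ^ 2 - P (n + 1) ^ 2) - √(ν n ^ 2 - P n ^ 2)) Filter.atTop (nhds δ)) →
      ∃ (m : ℕ → ℂ) (n₀ : ℕ)
      (κ₁ κ₂ δ : ℝ), 0 < κ₁ ∧ 0 < κ₂ ∧ (∀ n, m n ^ 2 + ((c * (ν n ^ 2) ^ α : ℝ) : ℂ) * m n +
        ((ν n ^ 2 : ℝ) : ℂ) = 0) ∧ (∀ n, n₀ ≤ n → κ₁ * ν n ^ (2 * min α (1 - α)) ≤ -(m n).re ∧
        -(m n).re ≤ κ₂ * ν n ^ (2 * min α (1 - α))) ∧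
      Filter.Tendsto (fun n => (m (n + 1)).im - (m n).im) Filter.atTop (nhds δ) := by
    rintro hα hev ⟨δ, hδ⟩
    obtain ⟨n₀, hn₀⟩ := Filter.eventually_atTop.1 hev
    refine ⟨fun n => charRoot (P n) (ν n), n₀, c / 2, c / 2, δ, by positivity, by positivity,
      hroot, fun n hn => ?_, ?_⟩
    · rw [min_eq_left (by linarith), (charRoot_underdamped (hn₀ n hn)).1, neg_neg, hPe]
      exact ⟨le_rfl, le_rfl⟩
    · refine hδ.congr' ?_
      filter_upwards [Filter.eventually_ge_atTop n₀] with n hn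
      rw [(charRoot_underdamped (hn₀ n hn)).2, (charRoot_underdamped (hn₀ (n + 1) (by omega))).2]
  rcases lt_trichotomy α (1 / 2) with hα | hα | hα
  · have hq0 : Filter.Tendsto (fun n => c / 2 * ν n ^ (2 * α - 1)) Filter.atTop (nhds 0) := by
      have h := ((tendsto_rpow_neg_atTop (show 0 < 1 - 2 * α by linarith)).comp
        (tendsto_sineFreq hab)).const_mul (c / 2)
      rw [mul_zero] at h
      refine h.congr fun n => ?_
      rw [Function.comp_apply, neg_sub]
    have hq1 := hq0.eventually_lt_const one_pos
    refine h_under hα.le ?_ ⟨Real.pi / (b - a), ?_⟩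
    · filter_upwards [hq1] with n hn
      rw [hPq]
      nlinarith [hν n]
    · set s : ℕ → ℝ := fun n => √(1 - (c / 2 * ν n ^ (2 * α - 1)) ^ 2) with hs
      have hs1 : Filter.Tendsto s Filter.atTop (nhds 1) := by
        have := ((hq0.pow 2).const_sub 1).sqrt
        simpa using this
      have hb : ∀ᶠ n in Filter.atTop, s n ^ 2 * (Real.pi / (b - a)) ≤
          √(ν (n + 1) ^ 2 - P (n + 1) ^ 2) - √(ν n ^ 2 - P n ^ 2) ∧
          √(ν (n + 1) ^ 2 - P (n + 1) ^ 2) - √(ν n ^ 2 - P n ^ 2) ≤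
            (Real.pi / (b - a)) / s n := by
        filter_upwards [hq1] with n hn
        have hνn := hν n
        have hνn' := hν (n + 1)
        have hle : ν n ≤ ν (n + 1) := by rw [hsucc]; linarith
        have hq : 0 < c / 2 * ν n ^ (2 * α - 1) := by positivity
        have hpos : 0 < 1 - (c / 2 * ν n ^ (2 * α - 1)) ^ 2 := by nlinarith
        have := damped_freq_gap (P' := P (n + 1)) (s := s n) hνn hπ (hP n).le ?_ (hPq n) ?_
          (Real.sqrt_pos.2 hpos) (Real.sq_sqrt hpos.le)
        · rwa [← hsucc] at this
        · rw [hPe, hPe]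
          gcongr
        · rw [hPq, ← hsucc]
          gcongr c / 2 * ?_ * _
          exact Real.rpow_le_rpow_of_nonpos hνn hle (by linarith)
      refine tendsto_of_tendsto_of_tendsto_of_le_of_le' ?_ ?_ (hb.mono fun n h => h.1)
        (hb.mono fun n h => h.2)
      · simpa using (hs1.pow 2).mul_const (Real.pi / (b - a))
      · have h := (tendsto_const_nhds (x := Real.pi / (b - a))).div hs1 one_ne_zero
        rw [div_one] at h
        exact h
  · have hPl : ∀ n, P n = c / 2 * ν n := fun n => by rw [hPq, hα]; norm_num
    rcases lt_or_ge c 2 with hc2 | hc2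
    · refine h_under hα.le (Filter.Eventually.of_forall fun n => ?_)
        ⟨√(1 - (c / 2) ^ 2) * (Real.pi / (b - a)), ?_⟩
      · rw [hPl]; nlinarith [hν n]
      · refine tendsto_const_nhds.congr fun n => ?_
        have e : ∀ n, √(ν n ^ 2 - P n ^ 2) = √(1 - (c / 2) ^ 2) * ν n := fun n => by
          rw [hPl, show ν n ^ 2 - (c / 2 * ν n) ^ 2 = (1 - (c / 2) ^ 2) * ν n ^ 2 by ring,
            Real.sqrt_mul (by nlinarith), Real.sqrt_sq (hν n).le]
        rw [e, e, hsucc]; ring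
    · refine h_over hα.ge (Filter.Eventually.of_forall fun n => ?_)
      rw [hPl]; nlinarith [hν n]
  · refine h_over hα.le ?_
    have h := ((tendsto_rpow_atTop (show 0 < 2 * α - 1 by linarith)).comp
      (tendsto_sineFreq hab)).const_mul_atTop (show 0 < c / 2 by positivity)
    filter_upwards [h.eventually_ge_atTop 1] with n hn
    rw [hPq]
    simp only [Function.comp_apply] at hn
    nlinarith [hν n]

/-! ### Sine series with rapidly decreasing coefficients -/

/-- The sine series with coefficients `C`, differentiated `p` times term by term. -/
noncomputable def sineSeries (a b : ℝ) (C : ℕ → ℝ) (p : ℕ) (x : ℝ) : ℝ :=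
  ∑' n, C n * (√(2 / (b - a)) * (sineFreq a b n ^ p *
    Real.sin (sineFreq a b n * (x - a) + p * (Real.pi / 2))))

theorem summable_sineSeries_bound {a b : ℝ} {C : ℕ → ℝ}
    (hC : ∀ p : ℕ, Summable fun n => |C n| * (1 + sineFreq a b n) ^ p) (p : ℕ) :
    Summable fun n => √(2 / (b - a)) * (|C n| * (1 + sineFreq a b n) ^ p) :=
  (hC p).mul_left _

theorem norm_sineSeries_term_le {a b : ℝ} (hab : a < b) (C : ℕ → ℝ) (p n : ℕ) (x : ℝ) :
    ‖C n * (√(2 / (b - a)) * (sineFreq a b n ^ p *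
      Real.sin (sineFreq a b n * (x - a) + p * (Real.pi / 2))))‖ ≤
      √(2 / (b - a)) * (|C n| * (1 + sineFreq a b n) ^ p) := by
  have hν := sineFreq_pos hab n
  rw [norm_mul, norm_mul, norm_mul, Real.norm_of_nonneg (Real.sqrt_nonneg _), Real.norm_eq_abs,
    Real.norm_of_nonneg (by positivity), Real.norm_eq_abs]
  calc |C n| * (√(2 / (b - a)) * (sineFreq a b n ^ p *
        |Real.sin (sineFreq a b n * (x - a) + p * (Real.pi / 2))|))
      ≤ |C n| * (√(2 / (b - a)) * ((1 + sineFreq a b n) ^ p * 1)) := by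
        gcongr
        · linarith
        · exact Real.abs_sin_le_one _
    _ = _ := by ring

theorem hasDerivAt_sineSeries {a b : ℝ} (hab : a < b) {C : ℕ → ℝ}
    (hC : ∀ p : ℕ, Summable fun n => |C n| * (1 + sineFreq a b n) ^ p) (p : ℕ) (x : ℝ) :
    HasDerivAt (sineSeries a b C p) (sineSeries a b C (p + 1) x) x := by
  refine hasDerivAt_tsum (summable_sineSeries_bound hC (p + 1)) (fun n y => ?_)
    (fun n y => norm_sineSeries_term_le hab C (p + 1) n y) (y₀ := x)
    (Summable.of_norm_bounded (summable_sineSeries_bound hC p)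
      fun n => norm_sineSeries_term_le hab C p n x) x
  have h1 : HasDerivAt (fun y : ℝ => sineFreq a b n * (y - a) + p * (Real.pi / 2))
      (sineFreq a b n) y := by
    simpa using (((hasDerivAt_id y).sub_const a).const_mul (sineFreq a b n)).add_const
      (p * (Real.pi / 2))
  have h2 := (((h1.sin).const_mul (sineFreq a b n ^ p)).const_mul √(2 / (b - a))).const_mul (C n)
  convert! h2 using 1
  have : sineFreq a b n * (y - a) + ((p + 1 : ℕ) : ℝ) * (Real.pi / 2) =
      (sineFreq a b n * (y - a) + p * (Real.pi / 2)) + Real.pi / 2 := by push_cast; ring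
  rw [this, Real.sin_add_pi_div_two]
  ring

theorem iteratedDeriv_sineSeries {a b : ℝ} (hab : a < b) {C : ℕ → ℝ}
    (hC : ∀ p : ℕ, Summable fun n => |C n| * (1 + sineFreq a b n) ^ p) (p : ℕ) :
    iteratedDeriv p (sineSeries a b C 0) = sineSeries a b C p := by
  induction p with
  | zero => exact iteratedDeriv_zero
  | succ p ih =>
    rw [iteratedDeriv_succ, ih]
    exact funext fun x => (hasDerivAt_sineSeries hab hC p x).deriv

theorem continuous_sineSeries {a b : ℝ} (hab : a < b) {C : ℕ → ℝ}
    (hC : ∀ p : ℕ, Summable fun n => |C n| * (1 + sineFreq a b n) ^ p) (p : ℕ) :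
    Continuous (sineSeries a b C p) :=
  continuous_iff_continuousAt.2 fun x => (hasDerivAt_sineSeries hab hC p x).continuousAt

/-- The sum in `L²` of a sine series agrees with its pointwise sum. -/
theorem coeFn_sineSeries {a b : ℝ} (hab : a < b) {C : ℕ → ℝ}
    (hC : ∀ p : ℕ, Summable fun n => |C n| * (1 + sineFreq a b n) ^ p) {F : L2 (Ioo a b)}
    (hF : HasSum (fun n => C n • sineL2 a b n) F) :
    F =ᵐ[volume.restrict (Ioo a b)] sineSeries a b C 0 := by
  have hterm : ∀ n x, C n * sineFun a b n x = C n * (√(2 / (b - a)) * (sineFreq a b n ^ 0 *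
      Real.sin (sineFreq a b n * (x - a) + (0 : ℕ) * (Real.pi / 2)))) := fun n x => by
    simp [sineFun]
  have hb : ∀ n x, ‖C n * sineFun a b n x‖ ≤ √(2 / (b - a)) * (|C n| * (1 + sineFreq a b n) ^ 0) :=
    fun n x => by rw [hterm]; exact norm_sineSeries_term_le hab C 0 n x
  have hsb := summable_sineSeries_bound hC 0
  have hcont : ∀ k, Continuous fun x => ∑ n ∈ Finset.range k, C n * sineFun a b n x := fun k =>
    continuous_finsetSum _ fun n _ => continuous_const.mul (continuous_sineFun a b n)
  have h1 := tendsto_contToL2 (a := a) (b := b) hcont (continuous_sineSeries hab hC 0)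
    (∑' n, √(2 / (b - a)) * (|C n| * (1 + sineFreq a b n) ^ 0)) (fun k x _ => by
      refine (Finset.abs_sum_le_sum_abs _ _).trans ((Finset.sum_le_sum fun n _ => hb n x).trans ?_)
      exact hsb.sum_le_tsum _ fun n _ => (norm_nonneg _).trans (hb n x)) (fun x _ => by
      have := (Summable.of_norm_bounded hsb fun n => hb n x).hasSum.tendsto_sum_nat
      simp_rw [hterm] at this ⊢
      exact this)
  have e : ∀ k, contToL2 a b _ (hcont k) = ∑ n ∈ Finset.range k, C n • sineL2 a b n := by
    intro k
    induction k with
    | zero =>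
      refine Lp.eq_zero_iff_ae_eq_zero.2 ?_
      filter_upwards [coeFn_contToL2 a b _ (hcont 0)] with x hx
      rw [hx]; simp
    | succ k ih =>
      rw [Finset.sum_range_succ, ← ih]
      refine Lp.ext ?_
      filter_upwards [coeFn_contToL2 a b _ (hcont (k + 1)), coeFn_contToL2 a b _ (hcont k),
        Lp.coeFn_add (contToL2 a b _ (hcont k)) (C k • sineL2 a b k),
        Lp.coeFn_smul (C k) (sineL2 a b k), coeFn_sineL2 a b k] with x g1 g2 g3 g4 g5
      rw [g1, g3, Pi.add_apply, g2, g4, Pi.smul_apply, g5, Finset.sum_range_succ, smul_eq_mul]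
  simp_rw [e] at h1
  rw [tendsto_nhds_unique hF.tendsto_sum_nat h1]
  exact coeFn_contToL2 _ _ _ _

theorem sineFreq_mul_midpoint {a b : ℝ} (hab : a < b) (n : ℕ) :
    sineFreq a b n * ((a + b) / 2 - a) = (n + 1) * (Real.pi / 2) := by
  have := (sub_pos.2 hab).ne'
  unfold sineFreq
  field_simp
  ring

theorem abs_sin_nat_mul_pi_div_two (k : ℕ) :
    |Real.sin (k * (Real.pi / 2))| = if Even k then 0 else 1 := by
  split_ifs with h
  · obtain ⟨j, rfl⟩ := h
    rw [show ((j + j : ℕ) : ℝ) * (Real.pi / 2) = j * Real.pi by push_cast; ring,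
      Real.sin_nat_mul_pi, abs_zero]
  · obtain ⟨j, rfl⟩ := Nat.not_even_iff_odd.1 h
    rw [show ((2 * j + 1 : ℕ) : ℝ) * (Real.pi / 2) = Real.pi / 2 + j * Real.pi by push_cast; ring,
      Real.sin_add_nat_mul_pi, Real.sin_pi_div_two, mul_one, abs_pow, abs_neg, abs_one, one_pow]

/-- At the midpoint the derivatives of order `p` only see the modes whose parity is that of `p`. -/
theorem sineSeries_midpoint {a b : ℝ} (hab : a < b) (C : ℕ → ℝ) (p : ℕ) :
    sineSeries a b C p ((a + b) / 2) = √(2 / (b - a)) *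
      ∑' n, C n * sineFreq a b n ^ p * Real.sin ((n + 1 + p : ℕ) * (Real.pi / 2)) := by
  rw [sineSeries, ← tsum_mul_left]
  refine tsum_congr fun n => ?_
  rw [sineFreq_mul_midpoint hab]
  push_cast
  rw [← add_mul]
  ring

/-- Stretched exponentials beat polynomials. -/
theorem summable_pow_mul_exp_neg_rpow {a b : ℝ} (hab : a < b) {κ γ : ℝ} (hκ : 0 < κ) (hγ : 0 < γ)
    (P : ℕ) : Summable fun n =>
      (1 + sineFreq a b n) ^ P * Real.exp (-(κ * sineFreq a b n ^ γ)) := by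
  have hL := sub_pos.2 hab
  have hs : Summable fun n => 2 ^ P * (sineFreq a b n ^ 2)⁻¹ := by
    have h := ((summable_nat_add_iff 1).2
      (Real.summable_nat_pow_inv (p := 2).2 (by norm_num))).mul_left
        (2 ^ P * ((Real.pi / (b - a)) ^ 2)⁻¹)
    refine h.congr fun n => ?_
    have : sineFreq a b n = Real.pi / (b - a) * ((n + 1 : ℕ) : ℝ) := by
      unfold sineFreq; push_cast; ring
    rw [this, mul_pow, mul_inv, mul_assoc]
  refine hs.of_norm_bounded_eventually_nat ?_
  have ht := tendsto_sineFreq hab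
  have h0 := (tendsto_rpow_mul_exp_neg_mul_atTop_nhds_zero (((P + 2 : ℕ) : ℝ) / γ) κ hκ).comp
    ((tendsto_rpow_atTop hγ).comp ht)
  filter_upwards [h0.eventually_le_const one_pos, ht.eventually_ge_atTop 1] with n h1 hν
  have hν0 : 0 < sineFreq a b n := by linarith
  simp only [Function.comp_apply] at h1
  rw [← Real.rpow_mul hν0.le, mul_div_cancel₀ _ hγ.ne', Real.rpow_natCast, pow_add,
    neg_mul] at h1
  rw [Real.norm_of_nonneg (by positivity), ← div_eq_mul_inv, le_div_iff₀ (by positivity)]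
  calc (1 + sineFreq a b n) ^ P * Real.exp (-(κ * sineFreq a b n ^ γ)) * sineFreq a b n ^ 2
      ≤ (2 * sineFreq a b n) ^ P * Real.exp (-(κ * sineFreq a b n ^ γ)) * sineFreq a b n ^ 2 := by
        gcongr; linarith
    _ = 2 ^ P * (sineFreq a b n ^ P * sineFreq a b n ^ 2 *
          Real.exp (-(κ * sineFreq a b n ^ γ))) := by rw [mul_pow]; ring
    _ ≤ 2 ^ P * 1 := by gcongr
    _ = 2 ^ P := mul_one _

/-! ### Sparse weights -/

/-- Two modes of nearly equal frequency cannot both vanish for all pairs in a sequence, if their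
phases agree for the even pairs and are in quadrature for the odd ones. -/
theorem frequently_le_abs_modalCoef {m w : ℕ → ℂ} {N : ℕ → ℕ} {δ : ℝ}
    (hN : Filter.Tendsto N Filter.atTop Filter.atTop)
    (hδ : Filter.Tendsto (fun n => (m (n + 1)).im - (m n).im) Filter.atTop (nhds δ))
    (hw : ∀ k, w (N k) = 1) (hw' : ∀ k, w (N k + 1) = if Even k then 1 else Complex.I) (t : ℝ) :
    ∃ᶠ k in Filter.atTop, ∃ n, (n = N k ∨ n = N k + 1) ∧
      1 / 4 * Real.exp ((m n).re * (t + 1)) ≤ |modalCoef m w n t| := by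
  intro hcon
  have hre : ∀ n, (Complex.exp (m n * ((t + 1 : ℝ) : ℂ))).re =
      Real.exp ((m n).re * (t + 1)) * Real.cos ((m n).im * (t + 1)) := fun n => by
    rw [Complex.exp_re, Complex.re_mul_ofReal, Complex.im_mul_ofReal]
  have him : ∀ n, (Complex.exp (m n * ((t + 1 : ℝ) : ℂ))).im =
      Real.exp ((m n).re * (t + 1)) * Real.sin ((m n).im * (t + 1)) := fun n => by
    rw [Complex.exp_im, Complex.re_mul_ofReal, Complex.im_mul_ofReal]
  have hdiv : ∀ {x y : ℝ}, ¬ 1 / 4 * Real.exp x ≤ |Real.exp x * y| → |y| ≤ 1 / 4 := by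
    intro x y h
    rw [abs_mul, abs_of_pos (Real.exp_pos x), not_le, mul_comm (1 / 4)] at h
    exact (lt_of_mul_lt_mul_left h (Real.exp_pos x).le).le
  have hev : ∀ᶠ k in Filter.atTop, |Real.cos ((m (N k)).im * (t + 1))| ≤ 1 / 4 ∧
      (Even k → |Real.cos ((m (N k + 1)).im * (t + 1))| ≤ 1 / 4) ∧
      (¬ Even k → |Real.sin ((m (N k + 1)).im * (t + 1))| ≤ 1 / 4) := by
    filter_upwards [hcon] with k hk
    have h0 := fun h => hk ⟨N k, Or.inl rfl, h⟩
    have h1 := fun h => hk ⟨N k + 1, Or.inr rfl, h⟩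
    simp only [modalCoef, hw, hw'] at h0 h1
    rw [one_mul, hre] at h0
    refine ⟨hdiv h0, fun he => ?_, fun he => ?_⟩
    · rw [if_pos he, one_mul, hre] at h1
      exact hdiv h1
    · rw [if_neg he, Complex.I_mul_re, him, abs_neg] at h1
      exact hdiv h1
  have hD : Filter.Tendsto (fun k => (m (N k + 1)).im * (t + 1) - (m (N k)).im * (t + 1))
      Filter.atTop (nhds (δ * (t + 1))) :=
    ((hδ.comp hN).mul_const (t + 1)).congr fun k => by simp only [Function.comp_apply]; ring
  have hprod : ∀ {x y z u : ℝ}, |x| ≤ 1 → |y| ≤ 1 / 4 → |z| ≤ 1 / 4 → |u| ≤ 1 →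
      |x * y| + |z * u| ≤ 1 / 2 := by
    intro x y z u hx hy hz hu
    rw [abs_mul, abs_mul]
    nlinarith [abs_nonneg x, abs_nonneg y, abs_nonneg z, abs_nonneg u]
  -- In the limit the even pairs force `sin (δ (t + 1))` to be small, the odd ones the cosine.
  have hsin : |Real.sin (δ * (t + 1))| ≤ 1 / 2 := by
    have h2 : Filter.Tendsto (fun j : ℕ => 2 * j) Filter.atTop Filter.atTop :=
      Filter.tendsto_id.const_mul_atTop' (by norm_num)
    refine le_of_tendsto ((Real.continuous_sin.tendsto _).comp (hD.comp h2)).abs ?_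
    filter_upwards [h2.eventually hev] with j hj
    simp only [Function.comp_apply]
    rw [Real.sin_sub]
    exact (abs_sub _ _).trans (hprod (Real.abs_sin_le_one _) hj.1 (hj.2.1 (even_two_mul j))
      (Real.abs_sin_le_one _))
  have hcos : |Real.cos (δ * (t + 1))| ≤ 1 / 2 := by
    have h2 : Filter.Tendsto (fun j : ℕ => 2 * j + 1) Filter.atTop Filter.atTop :=
      (Filter.tendsto_add_atTop_nat 1).comp (Filter.tendsto_id.const_mul_atTop' (by norm_num))
    refine le_of_tendsto ((Real.continuous_cos.tendsto _).comp (hD.comp h2)).abs ?_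
    filter_upwards [h2.eventually hev] with j hj
    simp only [Function.comp_apply]
    rw [Real.cos_sub]
    exact (abs_add_le _ _).trans (hprod (Real.abs_cos_le_one _) hj.1
      (hj.2.2 (by rw [Nat.not_even_iff_odd]; exact odd_two_mul_add_one j))
      (Real.abs_sin_le_one _))
  have hs := sq_le_sq' (by linarith [abs_nonneg (Real.sin (δ * (t + 1)))]) hsin
  have hc := sq_le_sq' (by linarith [abs_nonneg (Real.cos (δ * (t + 1)))]) hcos
  rw [sq_abs] at hs hc
  linarith [Real.sin_sq_add_cos_sq (δ * (t + 1))]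

/-- Lower bound for a sum `∑ f j` by its term `n`, when the terms vanish except for `j ≤ M + 1`,
`j = n` and `j ≥ N'`. -/
theorem abs_tsum_ge_of_sparse {f : ℕ → ℝ} {n M N' : ℕ} {A : ℝ} {g : ℕ → ℝ} (hf : Summable f)
    (hMn : M + 1 < n) (hnN : n < N') (hlow : ∀ j ≤ M + 1, |f j| ≤ A)
    (hz : ∀ j, M + 1 < j → j < N' → j ≠ n → f j = 0) (hg : Summable g)
    (hhigh : ∀ j, N' ≤ j → |f j| ≤ g j) :
    |f n| - (M + 2) * A - ∑' j, g (j + N') ≤ |∑' j, f j| := by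
  have h1 := hf.sum_add_tsum_nat_add N'
  have h2 : ∑ j ∈ Finset.range N', f j = f n + ∑ j ∈ Finset.range (M + 2), f j := by
    have hsub : insert n (Finset.range (M + 2)) ⊆ Finset.range N' := by
      intro j hj
      simp only [Finset.mem_insert, Finset.mem_range] at hj ⊢
      omega
    rw [← Finset.sum_subset hsub, Finset.sum_insert (by simp; omega)]
    intro j hj hj'
    simp only [Finset.mem_insert, Finset.mem_range] at hj hj'
    exact hz j (by omega) hj (by omega)
  have h3 : |∑ j ∈ Finset.range (M + 2), f j| ≤ (M + 2) * A := by
    refine (Finset.abs_sum_le_sum_abs _ _).trans ((Finset.sum_le_card_nsmul _ _ A fun j hj =>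
      hlow j (by rw [Finset.mem_range] at hj; omega)).trans (le_of_eq ?_))
    rw [Finset.card_range, nsmul_eq_mul]; push_cast; ring
  have h4 : |∑' j, f (j + N')| ≤ ∑' j, g (j + N') := by
    rw [← Real.norm_eq_abs]
    exact tsum_of_norm_bounded ((summable_nat_add_iff N').2 hg).hasSum
      fun j => hhigh _ (Nat.le_add_left _ _)
  rw [← h1, h2]
  have h5 : |f n| ≤ |f n + ∑ j ∈ Finset.range (M + 2), f j + ∑' j, f (j + N')| +
      |∑ j ∈ Finset.range (M + 2), f j| + |∑' j, f (j + N')| := by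
    have e : f n = (f n + ∑ j ∈ Finset.range (M + 2), f j + ∑' j, f (j + N')) -
      ∑ j ∈ Finset.range (M + 2), f j - ∑' j, f (j + N') := by ring
    calc |f n| = _ := congrArg _ e
      _ ≤ _ := (abs_sub _ _).trans (add_le_add_left (abs_sub _ _) _)
  linarith

/-- A sequence growing so fast that the tails of given series, depending on one term of the
sequence and cut at the next, stay bounded. -/
theorem exists_sparse_seq (g : ℕ → ℕ → ℝ) (n₀ : ℕ) :
    ∃ N : ℕ → ℕ, N 0 = n₀ ∧ ∀ k, (N k + 2) ^ 3 ≤ N (k + 1) ∧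
      ∑' j, g (N k) (j + N (k + 1)) ≤ 1 := by
  have h : ∀ M, ∃ M', (M + 2) ^ 3 ≤ M' ∧ ∑' j, g M (j + M') ≤ 1 := fun M =>
    ((Filter.eventually_ge_atTop _).and
      ((tendsto_sum_nat_add (g M)).eventually_le_const one_pos)).exists
  choose f hf using h
  refine ⟨fun k => f^[k] n₀, rfl, fun k => ?_⟩
  simp only [Function.iterate_succ_apply']
  exact hf _

open Classical in
/-- The weights of the modes: `1` at `N k`, at `N k + 1` in phase for even `k` and in quadrature
for odd `k`, and `0` elsewhere. -/
noncomputable def sparseWeight (N : ℕ → ℕ) (n : ℕ) : ℂ :=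
  if ∃ k, n = N k then 1
  else if ∃ k, Even k ∧ n = N k + 1 then 1
  else if ∃ k, n = N k + 1 then Complex.I
  else 0

theorem norm_sparseWeight_le (N : ℕ → ℕ) (n : ℕ) : ‖sparseWeight N n‖ ≤ 1 := by
  unfold sparseWeight
  split_ifs <;> simp

theorem exists_of_sparseWeight_ne_zero {N : ℕ → ℕ} {n : ℕ} (h : sparseWeight N n ≠ 0) :
    ∃ k, n = N k ∨ n = N k + 1 := by
  unfold sparseWeight at h
  split_ifs at h with h1 h2 h3
  · exact h1.imp fun _ => Or.inl
  · exact h2.imp fun _ h => Or.inr h.2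
  · exact h3.imp fun _ => Or.inr
  · exact absurd rfl h

theorem sparseWeight_self (N : ℕ → ℕ) (k : ℕ) : sparseWeight N (N k) = 1 :=
  if_pos ⟨k, rfl⟩

theorem strictMono_of_gap {N : ℕ → ℕ} (hgap : ∀ k, N k + 1 < N (k + 1)) : StrictMono N :=
  strictMono_nat_of_lt_succ fun k => by have := hgap k; omega

theorem add_one_lt_of_gap {N : ℕ → ℕ} (hgap : ∀ k, N k + 1 < N (k + 1)) {i j : ℕ} (hij : i < j) :
    N i + 1 < N j :=
  (hgap i).trans_le ((strictMono_of_gap hgap).monotone hij)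

theorem sparseWeight_add_one {N : ℕ → ℕ} (hgap : ∀ k, N k + 1 < N (k + 1)) (k : ℕ) :
    sparseWeight N (N k + 1) = if Even k then 1 else Complex.I := by
  have hmono := strictMono_of_gap hgap
  have h1 : ¬ ∃ j, N k + 1 = N j := by
    rintro ⟨j, hj⟩
    rcases lt_or_ge k j with h | h
    · have := add_one_lt_of_gap hgap h; omega
    · have := hmono.monotone h; omega
  have h2 : (∃ j, Even j ∧ N k + 1 = N j + 1) ↔ Even k := by
    constructor
    · rintro ⟨j, hj, h⟩
      rwa [hmono.injective (Nat.succ_injective h)]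
    · exact fun h => ⟨k, h, rfl⟩
  unfold sparseWeight
  rw [if_neg h1]
  by_cases hk : Even k
  · rw [if_pos (h2.2 hk), if_pos hk]
  · rw [if_neg (mt h2.1 hk), if_pos ⟨k, rfl⟩, if_neg hk]

/-- For sparse weights the derivatives of the superposition at the midpoint are bounded below, for
infinitely many orders `p`, by their single term whose decay rate is about `p`. -/
theorem frequently_le_abs_sineSeries_midpoint {a b : ℝ} (hab : a < b) {m w : ℕ → ℂ} {N : ℕ → ℕ}
    {γ κ₁ κ₂ t : ℝ} (hγ : 0 < γ) (hκ₁ : 0 < κ₁) (hκ₂ : 0 < κ₂) (ht : 0 ≤ t)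
    (hsupp : ∀ n, w n ≠ 0 → ∃ k, n = N k ∨ n = N k + 1) (hw : ∀ n, ‖w n‖ ≤ 1)
    (hdec : ∀ n, w n ≠ 0 → κ₁ * sineFreq a b n ^ γ ≤ -(m n).re ∧
      -(m n).re ≤ κ₂ * sineFreq a b n ^ γ)
    (hN : ∀ k, (N k + 2) ^ 3 ≤ N (k + 1))
    (htail : ∀ k, ∑' j, (1 + sineFreq a b (j + N (k + 1))) ^
      (⌈sineFreq a b (N k + 1) ^ γ⌉₊ + 1) *
        Real.exp (-(κ₁ * sineFreq a b (j + N (k + 1)) ^ γ)) ≤ 1)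
    (hC : ∀ p : ℕ, Summable fun n => |modalCoef m w n t| * (1 + sineFreq a b n) ^ p)
    (hfreq : ∃ᶠ k in Filter.atTop, ∃ n, (n = N k ∨ n = N k + 1) ∧
      1 / 4 * Real.exp ((m n).re * (t + 1)) ≤ |modalCoef m w n t|) :
    ∃ D > 0, ∃ᶠ p : ℕ in Filter.atTop, (D * (p : ℝ) ^ (1 / γ)) ^ p ≤
      |sineSeries a b (fun n => modalCoef m w n t) p ((a + b) / 2)| := by
  have hL := sub_pos.2 hab
  have hν : ∀ n, 0 < sineFreq a b n := sineFreq_pos hab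
  have hmonoν : ∀ {i j : ℕ}, i ≤ j → sineFreq a b i ≤ sineFreq a b j := fun {i j} hij => by
    unfold sineFreq; gcongr
  have hgap : ∀ k, N k + 1 < N (k + 1) := fun k => by
    have := hN k
    have h2 : N k + 2 ≤ (N k + 2) ^ 3 := Nat.le_self_pow (by norm_num) _
    omega
  have hmono := strictMono_of_gap hgap
  set K := κ₂ * (t + 1) with hK
  set η := min 1 (√(2 / (b - a)) / 16) with hη
  have hη0 : 0 < η := lt_min one_pos (by positivity)
  -- Term `n` is at least `Y ^ p / 4` with `Y = ν exp (-K)`, and `p ≤ 3 ν ^ γ`; the factor `η`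
  -- absorbs the constant in front of `Y ^ p`.
  refine ⟨η * Real.exp (-K) * (1 / 3) ^ (1 / γ), by positivity, ?_⟩
  rw [Filter.frequently_atTop]
  intro p₀
  have hNt := hmono.tendsto_atTop
  have hev : ∀ᶠ k in Filter.atTop, (p₀ : ℝ) ≤ sineFreq a b (N k) ^ γ ∧ 1 ≤ sineFreq a b (N k) ∧
      16 * Real.exp K ≤ sineFreq a b (N k) ∧ 16 * Real.exp K ≤ (N k : ℝ) := by
    have h1 := (tendsto_sineFreq hab).comp hNt
    exact (((tendsto_rpow_atTop hγ).comp h1).eventually_ge_atTop _).and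
      ((h1.eventually_ge_atTop _).and ((h1.eventually_ge_atTop _).and
        ((tendsto_natCast_atTop_atTop.comp hNt).eventually_ge_atTop _)))
  obtain ⟨k₀, hk₀⟩ := Filter.eventually_atTop.1 hev
  obtain ⟨k', hk', n, hn, hcn⟩ := Filter.frequently_atTop.1 hfreq (k₀ + 1)
  obtain ⟨k, rfl⟩ : ∃ k, k' = k + 1 := ⟨k' - 1, by omega⟩
  have hkk : k₀ ≤ k := by omega
  -- The order of differentiation: about the decay rate of mode `n`, of parity opposite to `n + 1`.
  set q := ⌈sineFreq a b n ^ γ⌉₊ with hq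
  obtain ⟨p, hpar, hp1, hp2⟩ : ∃ p, ¬ Even (n + 1 + p) ∧ q ≤ p ∧ p ≤ q + 1 := by
    by_cases h : Even (n + 1 + q)
    · exact ⟨q + 1, by rw [← add_assoc, Nat.even_add_one, not_not]; exact h, by omega, le_rfl⟩
    · exact ⟨q, h, le_rfl, by omega⟩
  have hNn : N (k + 1) ≤ n := by omega
  have hnN : n ≤ N (k + 1) + 1 := by omega
  obtain ⟨e1, e2, e3, -⟩ := hk₀ (k + 1) (by omega)
  have e4 := (hk₀ k hkk).2.2.2
  have hνn : sineFreq a b (N (k + 1)) ≤ sineFreq a b n := hmonoν hNn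
  have hq0 : sineFreq a b n ^ γ ≤ q := Nat.le_ceil _
  have hpow1 : 1 ≤ sineFreq a b n ^ γ := Real.one_le_rpow (e2.trans hνn) hγ.le
  have hqp : sineFreq a b n ^ γ ≤ p := hq0.trans (by exact_mod_cast hp1)
  have hp0 : p ≠ 0 := by
    rintro rfl
    norm_num at hqp
    linarith
  have hp3 : (p : ℝ) ≤ 3 * sineFreq a b n ^ γ := by
    have h1 : (p : ℝ) ≤ q + 1 := by exact_mod_cast hp2
    have h2 := (Nat.ceil_lt_add_one (zero_le_one.trans hpow1)).le
    linarith
  refine ⟨p, ?_, ?_⟩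
  · have : (p₀ : ℝ) ≤ p := e1.trans ((Real.rpow_le_rpow (hν _).le hνn hγ.le).trans hqp)
    exact_mod_cast this
  have hwn : w n ≠ 0 := by
    intro h
    have : modalCoef m w n t = 0 := by simp [modalCoef, h]
    rw [this, abs_zero] at hcn
    linarith [Real.exp_pos ((m n).re * (t + 1))]
  set Y := sineFreq a b n * Real.exp (-K) with hY
  have hexp : Real.exp K * Real.exp (-K) = 1 := by
    rw [← Real.exp_add, add_neg_cancel, Real.exp_zero]
  have hY0 : 0 < Y := mul_pos (hν n) (Real.exp_pos _)
  have hY16 : 16 ≤ Y := by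
    have := mul_le_mul_of_nonneg_right (e3.trans hνn) (Real.exp_pos (-K)).le
    rwa [mul_assoc, hexp, mul_one] at this
  set f : ℕ → ℝ := fun j => modalCoef m w j t * sineFreq a b j ^ p *
    Real.sin ((j + 1 + p : ℕ) * (Real.pi / 2)) with hf
  have hfle : ∀ j, |f j| ≤ |modalCoef m w j t| * sineFreq a b j ^ p := fun j => by
    have := hν j
    rw [hf]; simp only
    rw [abs_mul, abs_mul, abs_of_pos (pow_pos (hν j) p)]
    exact mul_le_of_le_one_right (by positivity) (Real.abs_sin_le_one _)
  have hfs : Summable f := by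
    refine (hC p).of_norm_bounded fun j => (hfle j).trans ?_
    gcongr
    · exact (hν j).le
    · linarith
  have hcoef : ∀ j, |modalCoef m w j t| ≤ Real.exp (-(κ₁ * sineFreq a b j ^ γ)) := fun j => by
    by_cases hj : w j = 0
    · simp only [modalCoef, hj, zero_mul, Complex.zero_re, abs_zero]; positivity
    · refine (abs_modalCoef_le m w j t).trans ((mul_le_of_le_one_left (Real.exp_pos _).le
        (hw j)).trans (Real.exp_le_exp.2 ?_))
      have h1 := (hdec j hj).1
      have h2 : 0 ≤ κ₁ * sineFreq a b j ^ γ := by have := hν j; positivity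
      nlinarith
  have hmain : 1 / 4 * Y ^ p ≤ |f n| := by
    rw [hf]; simp only
    rw [abs_mul, abs_mul, abs_of_pos (pow_pos (hν n) p), abs_sin_nat_mul_pi_div_two, if_neg hpar,
      mul_one, hY, mul_pow, ← Real.exp_nat_mul]
    have h1 : 1 / 4 * Real.exp (p * -K) ≤ |modalCoef m w n t| := by
      refine le_trans ?_ hcn
      refine mul_le_mul_of_nonneg_left (Real.exp_le_exp.2 ?_) (by norm_num)
      have h2 := (hdec n hwn).2
      have h3 : -(m n).re ≤ κ₂ * p := h2.trans (mul_le_mul_of_nonneg_left hqp hκ₂.le)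
      have h4 := mul_le_mul_of_nonneg_right h3 (show 0 ≤ t + 1 by linarith)
      rw [hK]; linarith
    calc _ = (1 / 4 * Real.exp (p * -K)) * sineFreq a b n ^ p := by ring
      _ ≤ _ := mul_le_mul_of_nonneg_right h1 (pow_pos (hν n) p).le
  have hbound := abs_tsum_ge_of_sparse (f := f) (n := n) (M := N k) (N' := N (k + 1 + 1))
    (A := sineFreq a b (N k + 1) ^ p)
    (g := fun j => (1 + sineFreq a b j) ^ (⌈sineFreq a b (N (k + 1) + 1) ^ γ⌉₊ + 1) *
        Real.exp (-(κ₁ * sineFreq a b j ^ γ))) hfs ((hgap k).trans_le hNn)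
    (hnN.trans_lt (hgap (k + 1))) ?_ ?_ (summable_pow_mul_exp_neg_rpow hab hκ₁ hγ _) ?_
  · -- The lower pairs contribute at most `Y ^ p / 16`, since `N` grows at least cubically; so do
    -- the higher ones, whose contribution is at most `1`.
    have hlow : 16 * ((N k + 2 : ℝ) * sineFreq a b (N k + 1) ^ p) ≤ Y ^ p := by
      have h1 : (16 * (N k + 2 : ℝ)) * sineFreq a b (N k + 1) ≤ Y := by
        have h2 : (N k + 2 : ℝ) ^ 2 * sineFreq a b (N k + 1) ≤ sineFreq a b n := by
          have h3 : ((N k + 2 : ℕ) : ℝ) ^ 3 ≤ n := by exact_mod_cast (hN k).trans hNn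
          push_cast at h3
          unfold sineFreq
          rw [mul_div_assoc', ← mul_assoc]
          gcongr
          push_cast
          nlinarith
        have h4 : 16 * Real.exp K * (N k + 2 : ℝ) * sineFreq a b (N k + 1) ≤ sineFreq a b n := by
          refine le_trans ?_ h2
          rw [pow_two]
          have := hν (N k + 1)
          gcongr
          linarith
        have h5 := mul_le_mul_of_nonneg_right h4 (Real.exp_pos (-K)).le
        rw [hY]
        calc _ = 16 * (N k + 2 : ℝ) * sineFreq a b (N k + 1) * (Real.exp K * Real.exp (-K)) := by
              rw [hexp, mul_one]
          _ = _ := by ring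
          _ ≤ _ := h5
      have h6 : (16 * (N k + 2 : ℝ)) ≤ (16 * (N k + 2 : ℝ)) ^ p :=
        le_self_pow₀ (by have : (0 : ℝ) ≤ N k := by positivity
                         linarith) hp0
      calc 16 * ((N k + 2 : ℝ) * sineFreq a b (N k + 1) ^ p)
          = (16 * (N k + 2 : ℝ)) * sineFreq a b (N k + 1) ^ p := by ring
        _ ≤ (16 * (N k + 2 : ℝ)) ^ p * sineFreq a b (N k + 1) ^ p :=
            mul_le_mul_of_nonneg_right h6 (pow_pos (hν _) p).le
        _ = ((16 * (N k + 2 : ℝ)) * sineFreq a b (N k + 1)) ^ p := (mul_pow _ _ _).symm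
        _ ≤ Y ^ p := pow_le_pow_left₀ (by have := hν (N k + 1); positivity) h1 p
    have hYp : 16 ≤ Y ^ p := hY16.trans (le_self_pow₀ (by linarith) hp0)
    have htl := htail (k + 1)
    have hsum : 1 / 16 * Y ^ p ≤ |∑' j, f j| := by linarith
    rw [sineSeries_midpoint hab, abs_mul, abs_of_nonneg (Real.sqrt_nonneg _)]
    have hroot : ((p : ℝ) / 3) ^ (1 / γ) ≤ sineFreq a b n := by
      calc ((p : ℝ) / 3) ^ (1 / γ) ≤ (sineFreq a b n ^ γ) ^ (1 / γ) := by
            gcongr; linarith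
        _ = sineFreq a b n := by
            rw [← Real.rpow_mul (hν n).le, mul_one_div_cancel hγ.ne', Real.rpow_one]
    have hDp : η * Real.exp (-K) * (1 / 3) ^ (1 / γ) * (p : ℝ) ^ (1 / γ) ≤ η * Y := by
      calc _ = η * Real.exp (-K) * ((p : ℝ) / 3) ^ (1 / γ) := by
            rw [mul_assoc _ ((1 / 3 : ℝ) ^ (1 / γ)), ← Real.mul_rpow (by norm_num) (by positivity)]
            congr 2; ring
        _ ≤ η * Real.exp (-K) * sineFreq a b n := by gcongr
        _ = η * Y := by rw [hY]; ring
    calc (η * Real.exp (-K) * (1 / 3) ^ (1 / γ) * (p : ℝ) ^ (1 / γ)) ^ p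
        ≤ (η * Y) ^ p := pow_le_pow_left₀ (by positivity) hDp p
      _ = η ^ p * Y ^ p := mul_pow _ _ _
      _ ≤ η * Y ^ p := by
          gcongr
          exact pow_le_of_le_one hη0.le (min_le_left _ _) hp0
      _ ≤ √(2 / (b - a)) / 16 * Y ^ p := by
          gcongr
          exact min_le_right _ _
      _ = √(2 / (b - a)) * (1 / 16 * Y ^ p) := by ring
      _ ≤ _ := mul_le_mul_of_nonneg_left hsum (Real.sqrt_nonneg _)
  · intro j hj
    refine (hfle j).trans ?_
    have h1 : |modalCoef m w j t| ≤ 1 := (hcoef j).trans (Real.exp_le_one_iff.2 (by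
      have := hν j
      have : 0 ≤ κ₁ * sineFreq a b j ^ γ := by positivity
      linarith))
    calc _ ≤ 1 * sineFreq a b (N k + 1) ^ p := by
          have := hν j
          gcongr
          exact hmonoν hj
      _ = _ := one_mul _
  · intro j hj1 hj2 hjn
    by_cases hwj : w j = 0
    · simp [hf, modalCoef, hwj]
    · obtain ⟨i, hi⟩ := hsupp j hwj
      have hik : i = k + 1 := by
        rcases lt_trichotomy i (k + 1) with h | h | h
        · have := hmono.monotone (Nat.lt_succ_iff.1 h); omega
        · exact h
        · have := hmono.monotone (Nat.succ_le_of_lt h)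
          simp only [Nat.succ_eq_add_one] at this
          omega
      rw [hik] at hi
      -- `j` and `n` are the two members of the same pair, hence of opposite parity.
      have hev : Even (j + 1 + p) := by
        rw [Nat.not_even_iff] at hpar
        rw [Nat.even_iff]
        omega
      have h0 : Real.sin ((j + 1 + p : ℕ) * (Real.pi / 2)) = 0 := by
        rw [← abs_eq_zero, abs_sin_nat_mul_pi_div_two, if_pos hev]
      simp only [hf, h0, mul_zero]
  · intro j _
    refine (hfle j).trans ?_
    rw [mul_comm]
    have := hν j
    have hpP : p ≤ ⌈sineFreq a b (N (k + 1) + 1) ^ γ⌉₊ + 1 := by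
      refine hp2.trans (Nat.succ_le_succ (Nat.ceil_le_ceil ?_))
      exact Real.rpow_le_rpow (hν _).le (hmonoν hnN) hγ.le
    calc sineFreq a b j ^ p * |modalCoef m w j t|
        ≤ (1 + sineFreq a b j) ^ p * Real.exp (-(κ₁ * sineFreq a b j ^ γ)) := by
          gcongr
          · linarith
          · exact hcoef j
      _ ≤ _ := by
          gcongr
          linarith

/-! ### Failure of Gevrey regularity -/

theorem false_of_frequently_of_gevrey {x : ℕ → ℝ} {D R r s : ℝ} (hD : 0 < D) (hrs : r < s)
    (hlow : ∃ᶠ p : ℕ in Filter.atTop, (D * (p : ℝ) ^ s) ^ p ≤ x p) (hR : 0 < R)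
    (hup : ∀ p : ℕ, 1 ≤ p → x p ≤ (R * (p : ℝ) ^ r) ^ p) : False := by
  have h := ((tendsto_rpow_atTop (sub_pos.2 hrs)).comp
    (tendsto_natCast_atTop_atTop (R := ℝ))).eventually_gt_atTop (R / D)
  obtain ⟨p, h1, h2, h3⟩ := (hlow.and_eventually (h.and (Filter.eventually_ge_atTop 1))).exists
  have hp : (0 : ℝ) < p := by exact_mod_cast h3
  simp only [Function.comp_apply] at h2
  rw [Real.rpow_sub hp, lt_div_iff₀ (by positivity), div_mul_eq_mul_div, div_lt_iff₀ hD] at h2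
  have h4 : (R * (p : ℝ) ^ r) ^ p < (D * (p : ℝ) ^ s) ^ p :=
    pow_lt_pow_left₀ (by linarith) (by positivity) (by omega)
  linarith [hup p h3]

theorem exists_iteratedDeriv_le_of_analyticAt {f : ℝ → ℝ} {x : ℝ} (hf : AnalyticAt ℝ f x) :
    ∃ R > 0, ∀ p : ℕ, 1 ≤ p → |iteratedDeriv p f x| ≤ (R * (p : ℝ) ^ (1 : ℝ)) ^ p := by
  obtain ⟨ρ, hρ⟩ := hf.hasFPowerSeriesAt
  obtain ⟨C, R, hC, hR, h⟩ := FormalMultilinearSeries.le_mul_pow_of_radius_pos _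
    (hρ.r_pos.trans_le hρ.r_le)
  refine ⟨max 1 C * R, by positivity, fun p hp => ?_⟩
  have h1 := h p
  rw [FormalMultilinearSeries.ofScalars_norm, norm_div, Real.norm_eq_abs, Real.norm_natCast,
    div_le_iff₀ (by positivity)] at h1
  have h2 : (p.factorial : ℝ) ≤ (p : ℝ) ^ p := by exact_mod_cast Nat.factorial_le_pow p
  have h3 : C ≤ max 1 C ^ p :=
    (le_max_right 1 C).trans (le_self_pow₀ (le_max_left _ _) (by omega))
  calc |iteratedDeriv p f x| ≤ C * R ^ p * p.factorial := h1
    _ ≤ max 1 C ^ p * R ^ p * (p : ℝ) ^ p := by gcongr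
    _ = _ := by rw [Real.rpow_one, mul_pow, mul_pow]

theorem max_one_div_eq {α : ℝ} (hα0 : 0 < α) (hα1 : α < 1) :
    max (1 / (2 * α)) (1 / (2 * (1 - α))) = 1 / (2 * min α (1 - α)) := by
  have h1 : 0 < 1 - α := by linarith
  rcases le_total α (1 - α) with h | h
  · rw [min_eq_left h, max_eq_left]
    gcongr
  · rw [min_eq_right h, max_eq_right]
    gcongr

/-- A solution with sparse data no derivative bound at the midpoint of which can beat the exponent
`s = max (1 / 2α) (1 / 2(1 - α))`. -/
theorem exists_solution_with_large_derivatives {a b : ℝ} (hab : a < b) {α c : ℝ} (hα0 : 0 < α)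
    (hα1 : α < 1) (hc : 0 < c) :
    ∃ u₀ ∈ H10 (Ioo a b), ∃ (u₁ : L2 (Ioo a b)) (u : ℝ → L2 (Ioo a b)),
      IsDampedWaveSolution (Ioo a b) α c u₀ u₁ u ∧
      ∀ t : ℝ, 0 < t → ∀ f : ℝ → ℝ, ContinuousOn f (Ioo a b) →
        u t =ᵐ[volume.restrict (Ioo a b)] f →
        ∃ D > 0, ∃ᶠ p : ℕ in Filter.atTop,
          (D * (p : ℝ) ^ max (1 / (2 * α)) (1 / (2 * (1 - α)))) ^ p ≤
            |iteratedDeriv p f ((a + b) / 2)| := by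
  obtain ⟨m, n₀, κ₁, κ₂, δ, hκ₁, hκ₂, hroot, hdec, hδ⟩ := exists_charRoots hab hα0 hα1 hc
  rw [max_one_div_eq hα0 hα1]
  set γ := 2 * min α (1 - α) with hγdef
  have hγ : 0 < γ := mul_pos two_pos (lt_min hα0 (by linarith))
  have hν : ∀ n, 0 < sineFreq a b n := sineFreq_pos hab
  obtain ⟨N, hN0, hN⟩ := exists_sparse_seq (fun M j => (1 + sineFreq a b j) ^
    (⌈sineFreq a b (M + 1) ^ γ⌉₊ + 1) * Real.exp (-(κ₁ * sineFreq a b j ^ γ))) n₀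
  have hgap : ∀ k, N k + 1 < N (k + 1) := fun k => by
    have := (hN k).1
    have h2 : N k + 2 ≤ (N k + 2) ^ 3 := Nat.le_self_pow (by norm_num) _
    omega
  have hmono := strictMono_of_gap hgap
  set w := sparseWeight N with hw
  have hsupp : ∀ n, w n ≠ 0 → ∃ k, n = N k ∨ n = N k + 1 :=
    fun n hn => exists_of_sparseWeight_ne_zero hn
  have hdec' : ∀ n, w n ≠ 0 → κ₁ * sineFreq a b n ^ γ ≤ -(m n).re ∧
      -(m n).re ≤ κ₂ * sineFreq a b n ^ γ := fun n hn => hdec n (by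
    obtain ⟨k, hk⟩ := hsupp n hn
    have := hmono.monotone (Nat.zero_le k)
    omega)
  have hre : ∀ n, w n ≠ 0 → (m n).re ≤ 0 := fun n hn => by
    have h1 := (hdec' n hn).1
    have h2 := hν n
    have h3 : 0 ≤ κ₁ * sineFreq a b n ^ γ := by positivity
    linarith
  have hsum : ∀ k : ℕ, Summable fun n =>
      ‖w n‖ * (1 + sineFreq a b n) ^ k * Real.exp ((m n).re / 2) := fun k => by
    refine Summable.of_nonneg_of_le (fun n => ?_) (fun n => ?_)
      (summable_pow_mul_exp_neg_rpow hab (half_pos hκ₁) hγ k)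
    · have := hν n
      positivity
    · have := hν n
      by_cases hn : w n = 0
      · rw [hn, norm_zero, zero_mul, zero_mul]
        positivity
      · have h1 : (m n).re / 2 ≤ -(κ₁ / 2 * sineFreq a b n ^ γ) := by
          linarith [(hdec' n hn).1]
        calc _ ≤ 1 * (1 + sineFreq a b n) ^ k *
              Real.exp (-(κ₁ / 2 * sineFreq a b n ^ γ)) := by
              gcongr
              exact norm_sparseWeight_le N n
          _ = _ := by rw [one_mul]
  have hsol := isDampedWaveSolution_modalSeries hab hα0 hα1 hc (fun n _ => hroot n) hre hsum
  refine ⟨modalSeries (sineL2 a b) m w 0, ?_, _, _, hsol, fun t ht f hf hfu => ?_⟩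
  · obtain ⟨p, -, hp⟩ := hsol.energy
    exact ⟨_, hp 0 le_rfl, rfl⟩
  have hC : ∀ p : ℕ, Summable fun n => |modalCoef m w n t| * (1 + sineFreq a b n) ^ p := fun p => by
    refine Summable.of_nonneg_of_le (fun n => ?_) (fun n => ?_) (hsum p)
    · have := hν n
      positivity
    · have := hν n
      calc _ ≤ ‖w n‖ * Real.exp ((m n).re / 2) * (1 + sineFreq a b n) ^ p := by
            gcongr
            exact abs_modalCoef_le_of_lt hre n (by linarith)
        _ = _ := by ring
  have hseries : HasSum (fun n => modalCoef m w n t • sineL2 a b n)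
      (modalSeries (sineL2 a b) m w t) := by
    refine hasSum_modalSeries hre ((hsum 0).congr fun n => ?_) (by linarith)
    rw [(orthonormal_sineL2 hab).1 n, pow_zero, mul_one, mul_one]
  have hF := coeFn_sineSeries hab hC hseries
  have heq : EqOn f (sineSeries a b (fun n => modalCoef m w n t) 0) (Ioo a b) :=
    Measure.eqOn_open_of_ae_eq (hfu.symm.trans hF) isOpen_Ioo hf
      (continuous_sineSeries hab hC 0).continuousOn
  have hmid : (a + b) / 2 ∈ Ioo a b := ⟨by linarith, by linarith⟩
  have hder : ∀ p : ℕ, iteratedDeriv p f ((a + b) / 2) =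
      sineSeries a b (fun n => modalCoef m w n t) p ((a + b) / 2) := fun p => by
    rw [← iteratedDeriv_sineSeries hab hC p]
    exact Filter.EventuallyEq.iteratedDeriv_eq p
      (heq.eventuallyEq_of_mem (isOpen_Ioo.mem_nhds hmid))
  simp_rw [hder]
  exact frequently_le_abs_sineSeries_midpoint hab hγ hκ₁ hκ₂ ht.le hsupp
    (norm_sparseWeight_le N) hdec' (fun k => (hN k).1) (fun k => (hN k).2) hC
    (frequently_le_abs_modalCoef hmono.tendsto_atTop hδ (sparseWeight_self N)
      (sparseWeight_add_one hgap) t)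

theorem mainTheorem5 (a b : ℝ) (hab : a < b) (α c : ℝ) (hα0 : 0 < α) (hα1 : α < 1) (hc : 0 < c) :
    (∀ r : ℝ, r < max (1 / (2 * α)) (1 / (2 * (1 - α))) →
      ∃ u₀ ∈ H10 (Ioo a b), ∃ (u₁ : L2 (Ioo a b)) (u : ℝ → L2 (Ioo a b)),
        IsDampedWaveSolution (Ioo a b) α c u₀ u₁ u ∧
        ∀ t : ℝ, 0 < t → ¬ MemGevrey r (Ioo a b) (u t)) ∧
    (α ≠ 1 / 2 →
      ∃ u₀ ∈ H10 (Ioo a b), ∃ (u₁ : L2 (Ioo a b)) (u : ℝ → L2 (Ioo a b)),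
        IsDampedWaveSolution (Ioo a b) α c u₀ u₁ u ∧
        ∀ t : ℝ, 0 < t → ¬ MemAnalytic (Ioo a b) (u t)) := by
  obtain ⟨u₀, hu₀, u₁, u, hsol, hu⟩ := exists_solution_with_large_derivatives hab hα0 hα1 hc
  have hmid : (a + b) / 2 ∈ Ioo a b := ⟨by linarith, by linarith⟩
  refine ⟨fun r hr => ⟨u₀, hu₀, u₁, u, hsol, ?_⟩, fun hα => ⟨u₀, hu₀, u₁, u, hsol, ?_⟩⟩
  · rintro t ht ⟨f, ⟨hf, hfK⟩, hfu⟩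
    obtain ⟨D, hD, hlow⟩ := hu t ht f hf.continuousOn hfu
    obtain ⟨R, hR, hup⟩ := hfK {(a + b) / 2} isCompact_singleton (singleton_subset_iff.2 hmid)
    refine false_of_frequently_of_gevrey hD hr hlow hR fun p hp => (hup p hp _ rfl).trans_eq ?_
    rw [mul_pow, Real.rpow_mul_natCast (Nat.cast_nonneg p)]
  · rintro t ht ⟨f, hf, hfu⟩
    obtain ⟨D, hD, hlow⟩ := hu t ht f hf.continuousOn hfu
    obtain ⟨R, hR, hup⟩ := exists_iteratedDeriv_le_of_analyticAt (hf _ hmid)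
    have hs : 1 < max (1 / (2 * α)) (1 / (2 * (1 - α))) := by
      rcases lt_or_gt_of_ne hα with h | h
      · exact lt_max_of_lt_left (by rw [lt_div_iff₀ (by linarith)]; linarith)
      · exact lt_max_of_lt_right (by rw [lt_div_iff₀ (by linarith)]; linarith)
    exact false_of_frequently_of_gevrey hD hs hlow hR hup
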